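/- Let $\sigma_1,\dots,\sigma_4$ be the standard generators of the braid group on five strands, let $$w=\sigma_1^2\sigma_2\sigma_1^{-1}\sigma_2\sigma_1\sigma_3^{-1}\sigma_2\sigma_4\sigma_3^{-1}\sigma_4^2,$$ and let $w^*$ be the braid obtained from $w$ by reversing all crossings (replacing each letter $\sigma_i^{\pm1}$ by $\sigma_i^{\mp1}$, in the same order). Let $K$ be the closure of the braid $ww^*ww^*$, oriented along the strands. Then $K$ is a knot (it has one component), and its Conway polynomial is $$C_K(z)=1-3z^2-33z^4+54z^6+535z^8+869z^{10}+489z^{12}+72z^{14}.$$ Here the Conway polynomial of a knot is the polynomial $C(z)\in\mathbb Z[z]$ with $C(0)=1$ for which $C(t^{1/2}-t^{-1/2})$ is the Alexander polynomial up to units. Moreover $K$ is positive amphicheiral: there is an orientation-reversing homeomorphism $S^3\to S^3$ which maps $K$ onto itself and preserves the orientation of $K$. The leading coefficient $72$ of $C_K$ is not a square. Consequently Stoimenow's conjecture, that the leading coefficient of the Conway polynomial of every amphicheiral knot is, up to sign, a square, is false. -/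

import Mathlib

/-- Euclidean three-space. -/
abbrev E3 : Type := EuclideanSpace ℝ (Fin 3)

/-- The unit three-sphere in Euclidean four-space. -/
abbrev S3 : Type := Metric.sphere (0 : EuclideanSpace ℝ (Fin 4)) 1

/-- Inverse stereographic projection, the standard inclusion of `ℝ³` into `S³ = ℝ³ ∪ {∞}`. -/
noncomputable def toS3 (p : E3) : S3 :=
  ⟨!₂[2 * p 0 / (‖p‖ ^ 2 + 1), 2 * p 1 / (‖p‖ ^ 2 + 1), 2 * p 2 / (‖p‖ ^ 2 + 1),
      (‖p‖ ^ 2 - 1) / (‖p‖ ^ 2 + 1)], by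
    have h1 : ‖p‖ ^ 2 = p 0 ^ 2 + p 1 ^ 2 + p 2 ^ 2 := by
      simp [EuclideanSpace.norm_sq_eq, Fin.sum_univ_three]
    have h2 : ‖p‖ ^ 2 + 1 ≠ 0 := by positivity
    rw [mem_sphere_zero_iff_norm, EuclideanSpace.norm_eq, Real.sqrt_eq_one]
    simp only [Real.norm_eq_abs, sq_abs, Fin.sum_univ_four]
    simp only [Matrix.cons_val]
    field_simp
    linear_combination -4 * h1⟩

/-! ### Oriented knots -/

/-- An oriented knot in `X`, given as a closed curve `γ : ℝ → X` of period one which is injective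
on the circle `ℝ / ℤ`. The orientation is the direction of increasing parameter. -/
structure IsKnot {X : Type*} [TopologicalSpace X] (γ : ℝ → X) : Prop where
  continuous : Continuous γ
  periodic : Function.Periodic γ 1
  injective : ∀ s t : ℝ, γ s = γ t → ∃ m : ℤ, s - t = m

/-- Ambient isotopy of parametrized oriented curves in `ℝ³`. -/
def AmbientIsotopic (γ γ' : ℝ → E3) : Prop :=
  ∃ H : unitInterval → (E3 ≃ₜ E3),
    Continuous (fun q : unitInterval × E3 => H q.1 q.2) ∧
      (∀ x, H 0 x = x) ∧ ∀ t, H 1 (γ t) = γ' t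

/-! ### Amphicheirality -/

/-- The reflection of `S³` that negates the last coordinate. -/
noncomputable def reflectS3 : C(S3, S3) where
  toFun x := ⟨!₂[x.1 0, x.1 1, x.1 2, -x.1 3], by
    have h := x.2
    rw [mem_sphere_zero_iff_norm, EuclideanSpace.norm_eq, Real.sqrt_eq_one] at h ⊢
    simpa [Fin.sum_univ_four] using h⟩
  continuous_toFun := by
    refine Continuous.subtype_mk ?_ _
    refine (PiLp.continuous_toLp 2 _).comp (continuous_pi fun i => ?_)
    fin_cases i <;> simp <;> fun_prop

/-- A self-homeomorphism of `S³` reverses orientation when its degree is `-1`, that is (maps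
`S³ → S³` being classified up to homotopy by their degree) when it is homotopic to a reflection. -/
def OrientationReversing (h : S3 ≃ₜ S3) : Prop :=
  ContinuousMap.Homotopic (h : C(S3, S3)) reflectS3

/-- A knot in `S³` is amphicheiral if some orientation-reversing homeomorphism of `S³` maps it
onto itself. -/
def Amphicheiral (γ : ℝ → S3) : Prop :=
  ∃ h : S3 ≃ₜ S3, OrientationReversing h ∧ h '' Set.range γ = Set.range γ

/-- An oriented knot in `S³` is positive amphicheiral if some orientation-reversing homeomorphism
of `S³` maps it onto itself preserving the orientation of the knot, that is, acts on the knot as an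
increasing reparametrization. -/
def PositiveAmphicheiral (γ : ℝ → S3) : Prop :=
  ∃ h : S3 ≃ₜ S3, OrientationReversing h ∧ ∃ φ : ℝ ≃o ℝ, ∀ t, h (γ t) = γ (φ t)

/-! ### The Conway polynomial of a knot, through a regular diagram -/

/-- The determinant of the plane projections of the velocities of `γ` at the parameters `s`, `t`. -/
noncomputable def crossDet (γ : ℝ → E3) (s t : ℝ) : ℝ :=
  deriv γ s 0 * deriv γ t 1 - deriv γ s 1 * deriv γ t 0

/-- The projection of `γ` to the `xy`-plane is a regular knot diagram with `n + 1` crossings, where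
the `k`-th crossing is passed from below at the parameter `u k` and from above at `o k`, and the
crossings are numbered in the order of their underpasses. The crossings are all the multiple points
of the projection (as `u` is injective, there are no triple points), and are transverse (`crossDet`
is zero if a velocity does not exist). -/
structure IsDiagram (γ : ℝ → E3) {n : ℕ} (u o : Fin (n + 1) → ℝ) : Prop where
  under_mem : ∀ k, u k ∈ Set.Ico (0 : ℝ) 1
  over_mem : ∀ k, o k ∈ Set.Ico (0 : ℝ) 1
  strictMono : StrictMono u
  proj_eq : ∀ k, γ (u k) 0 = γ (o k) 0 ∧ γ (u k) 1 = γ (o k) 1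
  height_lt : ∀ k, γ (u k) 2 < γ (o k) 2
  exhaustive : ∀ s ∈ Set.Ico (0 : ℝ) 1, ∀ t ∈ Set.Ico (0 : ℝ) 1,
    γ s 0 = γ t 0 → γ s 1 = γ t 1 →
      s = t ∨ ∃ k, (s = u k ∧ t = o k) ∨ (s = o k ∧ t = u k)
  transverse : ∀ k, crossDet γ (o k) (u k) ≠ 0

/-- The sign of the `k`-th crossing: `1` if the underpass crosses the overpass from right to left
and `-1` otherwise. -/
noncomputable def crossingSign (γ : ℝ → E3) {n : ℕ} (u o : Fin (n + 1) → ℝ)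
    (k : Fin (n + 1)) : ℤ :=
  (SignType.sign (crossDet γ (o k) (u k)) : ℤ)

/-- The underpasses cut the knot into `n + 1` arcs, indexed cyclically by `Fin (n + 1)`: arc `k`
ends at the underpass `u k` and arc `k + 1` begins there. This is the index of the arc that
contains the overpass `o k`, found by counting the underpasses before `o k`. -/
noncomputable def overArc {n : ℕ} (u o : Fin (n + 1) → ℝ) (k : Fin (n + 1)) : Fin (n + 1) :=
  Fin.ofNat (n + 1) (Nat.card {i : Fin (n + 1) // u i < o k})

open LaurentPolynomial in
/-- The Alexander matrix of the diagram, obtained by Fox calculus from the Wirtinger presentation: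
one row for each crossing and one column for each arc, where the row of a crossing of sign `ε` says
`(1 - t ^ ε) * over + t ^ ε * incoming - outgoing = 0`. The variable `T 1` of the Laurent
polynomials stands for `t ^ (1/2)`, so that `t ^ ε` is `T (2 * ε)`. -/
noncomputable def alexanderMatrix (γ : ℝ → E3) {n : ℕ} (u o : Fin (n + 1) → ℝ) :
    Matrix (Fin (n + 1)) (Fin (n + 1)) (LaurentPolynomial ℤ) :=
  Matrix.of fun k =>
    Pi.single (overArc u o k) (1 - T (2 * crossingSign γ u o k))
      + Pi.single k (T (2 * crossingSign γ u o k)) - Pi.single (k + 1) 1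

/-- The Alexander polynomial (in the variable `t ^ (1/2) = T 1`, and up to units) computed from the
diagram: the minor of the Alexander matrix in which the last row and the last column are deleted. -/
noncomputable def alexanderMinor (γ : ℝ → E3) {n : ℕ} (u o : Fin (n + 1) → ℝ) :
    LaurentPolynomial ℤ :=
  ((alexanderMatrix γ u o).submatrix Fin.castSucc Fin.castSucc).det

open LaurentPolynomial in
/-- `C` is the Conway polynomial of the knot `γ`: for a regular diagram of (a curve ambient isotopic
to) `γ`, the Alexander polynomial is, up to a unit `± t ^ (k/2)`, the result of substituting
`z = t ^ (1/2) - t ^ (-1/2)` in `C`, and `C` has the constant coefficient `1` of the Conway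
polynomial of a knot. -/
def HasConwayPolynomial (γ : ℝ → E3) (C : Polynomial ℤ) : Prop :=
  C.coeff 0 = 1 ∧
    ∃ γ' : ℝ → E3, AmbientIsotopic γ γ' ∧
      ∃ (n : ℕ) (u o : Fin (n + 1) → ℝ), IsDiagram γ' u o ∧
        Associated (Polynomial.aeval (T 1 - T (-1) : LaurentPolynomial ℤ) C)
          (alexanderMinor γ' u o)

/-- Stoimenow's conjecture: up to sign, the leading coefficient of the Conway polynomial of an
amphicheiral knot is a square. -/
def SquareLeadingCoeffConjecture : Prop :=
  ∀ γ : ℝ → E3, IsKnot γ → Amphicheiral (toS3 ∘ γ) →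
    ∀ C : Polynomial ℤ, HasConwayPolynomial γ C → IsSquare |C.leadingCoeff|

/-! ### Braids and their closures -/

/-- Words in the standard generators of the braid group on `n + 1` strands. The letter `(i, true)`
is the generator exchanging the strands in the positions `i` and `i + 1` (positions are numbered
from `0`), and `(i, false)` is its inverse. -/
abbrev BraidWord (n : ℕ) : Type := List (Fin n × Bool)

/-- The word with all crossings reversed. -/
def BraidWord.star {n : ℕ} (w : BraidWord n) : BraidWord n :=
  w.map fun l => (l.1, !l.2)

/-- The permutation of a braid word: the strand that starts in position `p` ends in position
`w.perm p`. -/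
def BraidWord.perm {n : ℕ} (w : BraidWord n) : Equiv.Perm (Fin (n + 1)) :=
  ((w.map fun l => Equiv.swap l.1.castSucc l.1.succ).reverse).prod

/-- The geometric picture of one letter, for the strand that enters in position `q`, at the
fraction `f` of the letter: the pair (position, height). The two strands that are exchanged move
linearly; for a positive letter the one moving up in position is in front. For `none` (no letter)
the strand stays where it is. -/
noncomputable def letterCurve {n : ℕ} (l : Option (Fin n × Bool)) (q : Fin (n + 1)) (f : ℝ) :
    ℝ × ℝ :=
  match l with
  | none => ((q : ℕ), 0)
  | some (i, b) =>
    ((1 - f) * (q : ℕ) + f * (Equiv.swap i.castSucc i.succ q : ℕ),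
      (if b then 1 else -1) *
        (if q = i.castSucc then 1 else if q = i.succ then -1 else 0) * (f * (1 - f)))

/-- The strand of the closed braid that starts in position `p`, after the fraction `x ∈ [0, 1)` of
a full turn about the braid axis, which is the `z`-axis. The letters of the word occupy consecutive
equal sectors, and the strand in position `q` is at distance `1 + q` from the axis. -/
noncomputable def BraidWord.strand {n : ℕ} (w : BraidWord n) (p : Fin (n + 1)) (x : ℝ) : E3 :=
  let k := ⌊(w.length : ℝ) * x⌋₊
  let c := letterCurve w[k]? (BraidWord.perm (w.take k) p) (Int.fract ((w.length : ℝ) * x))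
  !₂[(1 + c.1) * Real.cos (2 * Real.pi * x), (1 + c.1) * Real.sin (2 * Real.pi * x), c.2]

/-- The closure of a braid word, as a subset of `ℝ³`. -/
def BraidWord.closure {n : ℕ} (w : BraidWord n) : Set E3 :=
  {y | ∃ p : Fin (n + 1), ∃ x ∈ Set.Ico (0 : ℝ) 1, w.strand p x = y}

/-- The closed curve that runs through the closure of a braid word in the direction of the strands,
starting in position `0`, and makes `n + 1` full turns while the parameter increases by one. It
parametrizes the closure as an oriented knot if that closure has just one component. -/
noncomputable def BraidWord.closureCurve {n : ℕ} (w : BraidWord n) (t : ℝ) : E3 :=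
  w.strand ((w.perm ^ ⌊((n + 1 : ℕ) : ℝ) * t⌋) 0) (Int.fract (((n + 1 : ℕ) : ℝ) * t))

/-- The braid word `σ₁² σ₂ σ₁⁻¹ σ₂ σ₁ σ₃⁻¹ σ₂ σ₄ σ₃⁻¹ σ₄²` on five strands. -/
def braidW : BraidWord 4 :=
  [(0, true), (0, true), (1, true), (0, false), (1, true), (0, true), (2, false), (1, true),
    (3, true), (2, false), (3, true), (3, true)]

/-- The braid word `w w* w w*`. -/
def braidWW : BraidWord 4 :=
  braidW ++ braidW.star ++ braidW ++ braidW.star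

/-! Since `w` and `w*` differ only in signs, they have the same permutation, a 5-cycle. Follow the
single strand of the closure letter by letter: one turn is 48 letters, the whole knot is five turns,
that is 240 letters. After 60 letters (one turn and one block of 12) the strand is again in the same
position, the generator is the same, and all signs are opposite. So advancing the parameter by 1/4
amounts to a quarter turn about the braid axis with heights negated (`closureCurve_add_quarter`).
This map extends to an orthogonal reversal of orientation of `S³`, and it acts on the knot as a
translation of the parameter: `K` is positive amphicheiral.

Periodicity also reduces the geometry to finite tables. Two strands over the same letter either keep
their order or are exchanged and meet at its midpoint (`position_trichotomy`,
`closureCurve_proj_eq`). This gives injectivity and shows that the obvious diagram with 48 crossings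
is regular (`isDiagram_closureCurve`).

For the Alexander polynomial, cut the diagram along a half-plane bounded by the axis. It meets five
arcs; one gets the label 0 (its column is deleted), the other four are free. Going around the axis,
each crossing determines the label of its outgoing arc, so all equations but four are solved one
after another. What remains is a 4×4 determinant of closing conditions, equal to the minor up to a
unit (`Matrix.det_eq_det_mul_prod`). It is computed exactly in the kernel with coefficient lists
(`detFour_labelDefect`), and its leading coefficient as a polynomial in `z` is 72. -/

/-! ### The closed braid, letter by letter -/

/-- The position after `N` letters of the strand that starts in position `0`; it has period 60. -/
def position (N : ℤ) : ℤ :=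
  [0, 1, 0, 0, 1, 2, 2, 3, 3, 4, 4, 3, 4, 4, 4, 4, 4, 4, 4, 4, 4, 3, 2, 2, 2, 2, 2, 1, 0, 0,
    1, 1, 2, 2, 3, 4, 3, 3, 3, 3, 3, 3, 3, 2, 1, 1, 1, 1, 1, 0, 1, 2, 2, 1, 0, 0, 0, 0, 0,
    0].getD (N % 60).toNat 0

/-- The change of position during the letter `N`. -/
def positionStep (N : ℤ) : ℤ := position (N + 1) - position N

/-- The sign of the letter `N`. -/
def letterSign (N : ℤ) : ℤ :=
  [1, 1, 1, -1, 1, 1, -1, 1, 1, -1, 1, 1, -1, -1, -1, 1, -1, -1, 1, -1, -1, 1, -1, -1].getD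
    (N % 24).toNat 0

/-! ### Periodicity of the tables. -/

lemma position_add_mul (N k : ℤ) : position (N + 60 * k) = position N := by
  simp [position]

lemma positionStep_add_mul (N k : ℤ) : positionStep (N + 60 * k) = positionStep N := by
  rw [positionStep, positionStep, position_add_mul, add_right_comm, position_add_mul]

lemma letterSign_add_mul (N k : ℤ) : letterSign (N + 24 * k) = letterSign N := by
  simp [letterSign]

lemma position_emod (N : ℤ) : position (N % 60) = position N := by
  simp [position]

lemma position_emod_add (N k : ℤ) : position (N % 60 + k) = position (N + k) := by
  simp [position]

lemma positionStep_emod (N : ℤ) : positionStep (N % 60) = positionStep N := by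
  simp [positionStep, position]

lemma letterSign_emod (N : ℤ) : letterSign (N % 24) = letterSign N := by
  simp [letterSign]

/-- Turns a statement that is periodic in the letter into a finite check. -/
lemma forall_int_of_forall_fin {n : ℕ} [NeZero n] {p : ℤ → Prop} (hp : ∀ N : ℤ, p (N % n) → p N)
    (h : ∀ i : Fin n, p (i : ℕ)) (N : ℤ) : p N := by
  have hn : (0 : ℤ) < n := by exact_mod_cast Nat.pos_of_neZero n
  have h1 := Int.emod_nonneg N hn.ne'
  have h2 := Int.emod_lt_of_pos N hn
  refine hp N ?_
  have := h ⟨(N % n).toNat, by omega⟩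
  rwa [Int.toNat_of_nonneg h1] at this

lemma position_nonneg (N : ℤ) : 0 ≤ position N :=
  forall_int_of_forall_fin (n := 60) (p := fun N => 0 ≤ position N)
    (fun N h => by rwa [Nat.cast_ofNat, position_emod] at h) (by decide) N

/-- Blocks of 12 letters alternate between `w` and `w*`. -/
lemma letterSign_add_twelve (N : ℤ) : letterSign (N + 12) = -letterSign N :=
  forall_int_of_forall_fin (n := 24) (p := fun N => letterSign (N + 12) = -letterSign N)
    (fun N h => by
      rw [Nat.cast_ofNat, letterSign_emod] at h
      rw [← h]
      simp [letterSign]) (by decide) N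

lemma letterSign_add_sixty (N : ℤ) : letterSign (N + 60) = -letterSign N := by
  rw [show N + 60 = N + 12 + 24 * 2 by ring, letterSign_add_mul, letterSign_add_twelve]

lemma letterSign_eq (N : ℤ) : letterSign N = 1 ∨ letterSign N = -1 :=
  forall_int_of_forall_fin (n := 24) (p := fun N => letterSign N = 1 ∨ letterSign N = -1)
    (fun N h => by rwa [Nat.cast_ofNat, letterSign_emod] at h) (by decide +kernel) N

lemma letterSign_ne_zero (N : ℤ) : letterSign N ≠ 0 :=
  forall_int_of_forall_fin (n := 24) (p := fun N => letterSign N ≠ 0)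
    (fun N h => by rwa [Nat.cast_ofNat, letterSign_emod] at h) (by decide) N

/-- Two strands passing through the same letter keep their order, or are exchanged. -/
lemma position_trichotomy (N : ℤ) (j : Fin 4) :
    (position N < position (N + 48 * (j + 1 : ℕ)) ∧
      position (N + 1) < position (N + 48 * (j + 1 : ℕ) + 1)) ∨
    (position (N + 48 * (j + 1 : ℕ)) < position N ∧
      position (N + 48 * (j + 1 : ℕ) + 1) < position (N + 1)) ∨
    (position (N + 48 * (j + 1 : ℕ)) ≠ position N ∧
      position (N + 48 * (j + 1 : ℕ)) = position (N + 1) ∧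
      position (N + 48 * (j + 1 : ℕ) + 1) = position N) := by
  revert j
  refine forall_int_of_forall_fin (n := 60) (p := fun N => ∀ j : Fin 4,
    (position N < position (N + 48 * (j + 1 : ℕ)) ∧
      position (N + 1) < position (N + 48 * (j + 1 : ℕ) + 1)) ∨
    (position (N + 48 * (j + 1 : ℕ)) < position N ∧
      position (N + 48 * (j + 1 : ℕ) + 1) < position (N + 1)) ∨
    (position (N + 48 * (j + 1 : ℕ)) ≠ position N ∧
      position (N + 48 * (j + 1 : ℕ)) = position (N + 1) ∧
      position (N + 48 * (j + 1 : ℕ) + 1) = position N)) (fun N h j => ?_) (by decide +kernel) N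
  simpa only [Nat.cast_ofNat, add_assoc, position_emod_add, position_emod] using h j

/-! ### Comparison of the tables with the braid word. -/

lemma braidWW_length : braidWW.length = 48 := rfl

/-- The letter number `r` of the word. -/
def braidLetter (r : ℕ) : Fin 4 × Bool := braidWW.getD r (0, true)

/-- Ties the tables to the word: after `q` turns and `r` letters, the two descriptions of letter,
position and height agree. Five turns suffice because the permutation has order dividing 5. -/
lemma braidLetter_spec (q : Fin 5) (r : Fin 48) :
    braidWW[(r : ℕ)]? = some (braidLetter r) ∧
    ((BraidWord.perm (braidWW.take r) ((braidWW.perm ^ (q : ℕ)) 0) : ℕ) : ℤ)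
      = position (48 * (q : ℕ) + (r : ℕ)) ∧
    ((Equiv.swap (braidLetter r).1.castSucc (braidLetter r).1.succ
      (BraidWord.perm (braidWW.take r) ((braidWW.perm ^ (q : ℕ)) 0)) : ℕ) : ℤ)
      = position (48 * (q : ℕ) + (r : ℕ) + 1) ∧
    (if (braidLetter r).2 then 1 else -1) *
      (if BraidWord.perm (braidWW.take r) ((braidWW.perm ^ (q : ℕ)) 0)
          = (braidLetter r).1.castSucc then 1
        else if BraidWord.perm (braidWW.take r) ((braidWW.perm ^ (q : ℕ)) 0)
          = (braidLetter r).1.succ then -1 else 0)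
      = letterSign (48 * (q : ℕ) + (r : ℕ)) * positionStep (48 * (q : ℕ) + (r : ℕ)) := by
  revert q r
  decide +kernel

lemma braidWW_perm_pow_five : braidWW.perm ^ 5 = 1 := by
  decide +kernel

lemma braidWW_perm_zpow (q : ℤ) : braidWW.perm ^ q = braidWW.perm ^ (q % 5).toNat := by
  have h : (0 : ℤ) ≤ q % 5 := Int.emod_nonneg q (by norm_num)
  conv_lhs => rw [← Int.mul_ediv_add_emod q 5, zpow_add, zpow_mul]
  rw [show (braidWW.perm ^ (5 : ℤ)) = 1 from by exact_mod_cast braidWW_perm_pow_five, one_zpow,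
    one_mul]
  conv_lhs => rw [← Int.toNat_of_nonneg h, zpow_natCast]

/-- The closed braid in cylindrical coordinates. -/
noncomputable def cylinderPoint (r θ z : ℝ) : E3 := !₂[r * Real.cos θ, r * Real.sin θ, z]

/-- The part of the closed braid that lies over the letter `N`. -/
noncomputable def braidPiece (N : ℤ) (f : ℝ) : E3 :=
  cylinderPoint (1 + (position N + f * positionStep N)) (2 * Real.pi * ((N + f) / 48))
    (letterSign N * positionStep N * (f * (1 - f)))

lemma closureCurve_eq_braidPiece_fract (t : ℝ) :
    braidWW.closureCurve t = braidPiece ⌊240 * t⌋ (Int.fract (240 * t)) := by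
  obtain ⟨N, hN⟩ : ∃ N, N = ⌊240 * t⌋ := ⟨_, rfl⟩
  obtain ⟨f, hf⟩ : ∃ f, f = Int.fract (240 * t) := ⟨_, rfl⟩
  have hf0 : 0 ≤ f := hf ▸ Int.fract_nonneg _
  have hf1 : f < 1 := hf ▸ Int.fract_lt_one _
  have hNf : 240 * t = N + f := by rw [hN, hf, Int.floor_add_fract]
  rw [← hN, ← hf]
  obtain ⟨r, hr⟩ := Int.eq_ofNat_of_zero_le (Int.emod_nonneg N (b := 48) (by norm_num))
  have hr48 : r < 48 := by
    have := Int.emod_lt_of_pos N (b := 48) (by norm_num)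
    omega
  obtain ⟨q, hq⟩ : ∃ q, q = N / 48 := ⟨_, rfl⟩
  have hdiv : N = 48 * q + r := by omega
  have hdivR : (N : ℝ) = 48 * q + r := by exact_mod_cast hdiv
  have hr48R : (r : ℝ) + 1 ≤ 48 := by exact_mod_cast hr48
  have hr0R : (0 : ℝ) ≤ r := by positivity
  have h5 : ((4 + 1 : ℕ) : ℝ) * t = q + (r + f) / 48 := by
    push_cast
    linarith
  have hfl : ⌊((4 + 1 : ℕ) : ℝ) * t⌋ = q := by
    rw [Int.floor_eq_iff, h5]
    constructor <;> linarith
  have hfr : Int.fract (((4 + 1 : ℕ) : ℝ) * t) = (r + f) / 48 := by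
    rw [Int.fract, hfl, h5]
    ring
  have hx : (braidWW.length : ℝ) * ((r + f) / 48) = r + f := by
    rw [braidWW_length]
    push_cast
    ring
  have hk : ⌊(r : ℝ) + f⌋₊ = r := by
    rw [Nat.floor_eq_iff (by positivity)]
    constructor <;> linarith
  have hfrf : Int.fract ((r : ℝ) + f) = f := by
    rw [Int.fract_natCast_add, Int.fract_eq_self.2 ⟨hf0, hf1⟩]
  have hm0 : (0 : ℤ) ≤ q % 5 := Int.emod_nonneg q (by norm_num)
  have hm5 : (q % 5).toNat < 5 := by
    have := Int.emod_lt_of_pos q (b := 5) (by norm_num)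
    omega
  -- Five turns are 240 letters, a multiple of both periods 60 and 24, so the number of turns only
  -- matters modulo 5.
  have hN240 : N = 48 * ((q % 5).toNat : ℤ) + (r : ℤ) + 240 * (q / 5) := by
    rw [Int.toNat_of_nonneg hm0]
    omega
  obtain ⟨s1, s2, s3, s4⟩ := braidLetter_spec ⟨(q % 5).toNat, hm5⟩ ⟨r, hr48⟩
  simp only at s1 s2 s3 s4
  obtain ⟨p, hp⟩ : ∃ p, p = BraidWord.perm (braidWW.take r)
    ((braidWW.perm ^ (q % 5).toNat) 0) := ⟨_, rfl⟩
  rw [← hp] at s2 s3 s4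
  have e2 : position (48 * ((q % 5).toNat : ℤ) + (r : ℤ)) = position N := by
    rw [hN240, show (240 : ℤ) * (q / 5) = 60 * (4 * (q / 5)) by ring, position_add_mul]
  have e3 : position (48 * ((q % 5).toNat : ℤ) + (r : ℤ) + 1) = position (N + 1) := by
    rw [hN240, show (48 * ((q % 5).toNat : ℤ) + (r : ℤ)) + (240 : ℤ) * (q / 5) + 1
      = (48 * ((q % 5).toNat : ℤ) + (r : ℤ) + 1) + 60 * (4 * (q / 5)) by ring, position_add_mul]
  have e4 : letterSign (48 * ((q % 5).toNat : ℤ) + (r : ℤ)) = letterSign N := by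
    rw [hN240, show (240 : ℤ) * (q / 5) = 24 * (10 * (q / 5)) by ring, letterSign_add_mul]
  have e5 : positionStep (48 * ((q % 5).toNat : ℤ) + (r : ℤ)) = positionStep N := by
    rw [positionStep, positionStep, e2, e3]
  rw [e2] at s2
  rw [e3] at s3
  rw [e4, e5] at s4
  have hangle : 2 * Real.pi * ((N + f) / 48)
      = 2 * Real.pi * ((r + f) / 48) + q * (2 * Real.pi) := by
    rw [hdivR]
    ring
  rw [BraidWord.closureCurve, hfl, hfr, braidWW_perm_zpow, braidPiece, cylinderPoint, hangle,
    Real.cos_add_int_mul_two_pi, Real.sin_add_int_mul_two_pi]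
  simp only [BraidWord.strand, hx, hk, hfrf, s1, letterCurve, ← hp]
  have s2' := congrArg (Int.cast : ℤ → ℝ) s2
  have s3' := congrArg (Int.cast : ℤ → ℝ) s3
  have s4' := congrArg (Int.cast : ℤ → ℝ) s4
  push_cast at s2' s3' s4'
  rw [s2', s3', s4', show (1 - f) * (position N : ℝ) + f * (position (N + 1) : ℝ)
    = position N + f * positionStep N by rw [positionStep]; push_cast; ring]

/-! ### Cylindrical coordinates and continuity. -/

@[simp] lemma cylinderPoint_zero (r θ z : ℝ) : cylinderPoint r θ z 0 = r * Real.cos θ := rfl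

@[simp] lemma cylinderPoint_one (r θ z : ℝ) : cylinderPoint r θ z 1 = r * Real.sin θ := rfl

@[simp] lemma cylinderPoint_two (r θ z : ℝ) : cylinderPoint r θ z 2 = z := rfl

lemma cylinderPoint_add_int_mul_two_pi (r θ z : ℝ) (k : ℤ) :
    cylinderPoint r (θ + k * (2 * Real.pi)) z = cylinderPoint r θ z := by
  simp only [cylinderPoint, Real.cos_add_int_mul_two_pi, Real.sin_add_int_mul_two_pi]

lemma continuous_cylinderPoint {X : Type*} [TopologicalSpace X] {r θ z : X → ℝ}
    (hr : Continuous r) (hθ : Continuous θ) (hz : Continuous z) :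
    Continuous fun x => cylinderPoint (r x) (θ x) (z x) := by
  refine (PiLp.continuous_toLp 2 _).comp (continuous_pi fun i => ?_)
  fin_cases i <;> simp <;> fun_prop

lemma cylinderPoint_proj_inj {r r' θ θ' z z' : ℝ} (hr : 0 < r) (hr' : 0 < r')
    (h0 : cylinderPoint r θ z 0 = cylinderPoint r' θ' z' 0)
    (h1 : cylinderPoint r θ z 1 = cylinderPoint r' θ' z' 1) :
    r = r' ∧ ∃ k : ℤ, θ - θ' = 2 * Real.pi * k := by
  simp only [cylinderPoint_zero, cylinderPoint_one] at h0 h1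
  have hrr : r = r' := by
    have : r ^ 2 = r' ^ 2 := by
      linear_combination (r * Real.cos θ + r' * Real.cos θ') * h0
        + (r * Real.sin θ + r' * Real.sin θ') * h1
        - r ^ 2 * Real.sin_sq_add_cos_sq θ + r' ^ 2 * Real.sin_sq_add_cos_sq θ'
    exact (pow_left_inj₀ hr.le hr'.le two_ne_zero).1 this
  subst hrr
  exact ⟨rfl, Real.Angle.angle_eq_iff_two_pi_dvd_sub.1 (Real.Angle.cos_sin_inj
    (mul_left_cancel₀ hr.ne' h0) (mul_left_cancel₀ hr.ne' h1))⟩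

lemma braidPiece_one_right (N : ℤ) : braidPiece N 1 = braidPiece (N + 1) 0 := by
  simp [braidPiece, positionStep]

lemma continuous_braidPiece (N : ℤ) : Continuous (braidPiece N) :=
  continuous_cylinderPoint (by fun_prop) (by fun_prop) (by fun_prop)

/-- The right endpoint is included so that the pieces live on closed intervals, which form a locally
finite closed cover of the line and can be glued. -/
lemma closureCurve_eq_braidPiece {N : ℤ} {t : ℝ} (h0 : N ≤ 240 * t) (h1 : 240 * t ≤ N + 1) :
    braidWW.closureCurve t = braidPiece N (240 * t - N) := by
  rw [closureCurve_eq_braidPiece_fract]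
  rcases h1.lt_or_eq with h1 | h1
  · rw [Int.fract, Int.floor_eq_iff.2 ⟨h0, h1⟩]
  · rw [h1, show (N : ℝ) + 1 = (N + 1 : ℤ) by push_cast; rfl, Int.floor_intCast, Int.fract_intCast,
      ← braidPiece_one_right]
    push_cast
    rw [add_sub_cancel_left]

lemma continuous_closureCurve : Continuous braidWW.closureCurve := by
  have hcov : ⋃ N : ℤ, {t : ℝ | 240 * t ∈ Set.Icc (N : ℝ) (N + 1)} = Set.univ :=
    Set.eq_univ_of_forall fun t =>
      Set.mem_iUnion.2 ⟨⌊240 * t⌋, Int.floor_le _, (Int.lt_floor_add_one _).le⟩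
  have hfin : LocallyFinite fun N : ℤ => Set.Icc (N : ℝ) (N + 1) :=
    locallyFinite_Icc_of_tendsto tendsto_intCast_atTop_atTop
      (Filter.tendsto_atBot_add_const_right _ _ (tendsto_intCast_atBot_iff.2 Filter.tendsto_id))
  refine (hfin.preimage_continuous (continuous_const_mul (240 : ℝ))).continuous hcov
    (fun N => isClosed_Icc.preimage (continuous_const_mul (240 : ℝ))) fun N => ?_
  refine ContinuousOn.congr (f := fun t => braidPiece N (240 * t - N))
    ((continuous_braidPiece N).comp (by fun_prop)).continuousOn fun t ht => ?_
  exact closureCurve_eq_braidPiece ht.1 ht.2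

/-! ### The quarter-turn symmetry. -/

/-- The rotation by a quarter turn about the braid axis, followed by a reflection in the
`xy`-plane. -/
noncomputable def quarterTurn (p : E3) : E3 := !₂[-p 1, p 0, -p 2]

lemma closureCurve_add_quarter (t : ℝ) :
    braidWW.closureCurve (t + 1 / 4) = quarterTurn (braidWW.closureCurve t) := by
  have h0 := Int.floor_le (240 * t)
  have h1 := (Int.lt_floor_add_one (240 * t)).le
  rw [closureCurve_eq_braidPiece h0 h1,
    closureCurve_eq_braidPiece (N := ⌊240 * t⌋ + 60) (by push_cast; linarith)
      (by push_cast; linarith)]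
  generalize ⌊240 * t⌋ = N
  have hp : position (N + 60) = position N := position_add_mul N 1
  have hd : positionStep (N + 60) = positionStep N := positionStep_add_mul N 1
  rw [braidPiece, braidPiece, hp, hd, letterSign_add_sixty]
  push_cast
  -- Sixty letters turn the angle by `5π/2`, a full turn and a quarter.
  rw [show 240 * (t + 1 / 4) - ((N : ℝ) + 60) = 240 * t - N by ring,
    show 2 * Real.pi * (((N : ℝ) + 60 + (240 * t - N)) / 48)
      = 2 * Real.pi * (((N : ℝ) + (240 * t - N)) / 48) + Real.pi / 2 + 2 * Real.pi by ring]
  simp only [cylinderPoint, quarterTurn, Real.cos_add_two_pi, Real.sin_add_two_pi,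
    Real.cos_add_pi_div_two, Real.sin_add_pi_div_two]
  simp

lemma periodic_closureCurve : Function.Periodic braidWW.closureCurve 1 := by
  intro t
  rw [show t + 1 = t + 1 / 4 + 1 / 4 + 1 / 4 + 1 / 4 by ring]
  simp only [closureCurve_add_quarter]
  ext i
  fin_cases i <;> simp [quarterTurn]

/-! ### Double points of the projection and injectivity. -/

/-- The letters `N` and `N'` are the two passes through a crossing. -/
def IsCrossingPair (N N' : ℤ) : Prop :=
  (∃ k, N' = N + 48 * k) ∧ position N' = position (N + 1) ∧ position (N' + 1) = position N ∧
    position N' ≠ position N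

lemma IsCrossingPair.symm {N N' : ℤ} (h : IsCrossingPair N N') : IsCrossingPair N' N := by
  obtain ⟨⟨k, hk⟩, h1, h2, h3⟩ := h
  exact ⟨⟨-k, by omega⟩, h2.symm, h1.symm, h3.symm⟩

lemma IsCrossingPair.positionStep_eq_neg {N N' : ℤ} (h : IsCrossingPair N N') :
    positionStep N' = -positionStep N := by
  rw [positionStep, positionStep, h.2.1, h.2.2.1]
  ring

lemma IsCrossingPair.positionStep_ne_zero {N N' : ℤ} (h : IsCrossingPair N N') :
    positionStep N ≠ 0 := by
  rw [positionStep, ← h.2.1]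
  exact sub_ne_zero.2 h.2.2.2

lemma IsCrossingPair.letterSign_eq {N N' : ℤ} (h : IsCrossingPair N N') :
    letterSign N' = letterSign N := by
  obtain ⟨⟨k, rfl⟩, -⟩ := h
  rw [show (48 : ℤ) * k = 24 * (2 * k) by ring, letterSign_add_mul]

/-- Because 5 · 48 is a multiple of 60, only the residue of `k` modulo 5 matters; the nonzero
residues are the four cases of `position_trichotomy`. -/
lemma position_cases (N k : ℤ) :
    (∃ m, k = 5 * m) ∨
    (position N < position (N + 48 * k) ∧ position (N + 1) < position (N + 48 * k + 1)) ∨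
    (position (N + 48 * k) < position N ∧ position (N + 48 * k + 1) < position (N + 1)) ∨
    IsCrossingPair N (N + 48 * k) := by
  obtain ⟨j, hj⟩ := Int.eq_ofNat_of_zero_le (Int.emod_nonneg k (b := 5) (by norm_num))
  have hj5 := Int.emod_lt_of_pos k (b := 5) (by norm_num)
  obtain rfl | ⟨i, rfl⟩ : j = 0 ∨ ∃ i, j = i + 1 := by cases j <;> simp
  · exact Or.inl ⟨k / 5, by omega⟩
  · refine Or.inr ?_
    have e : 48 * k = 48 * ((i + 1 : ℕ) : ℤ) + 60 * (4 * (k / 5)) := by omega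
    have e1 : position (N + 48 * k) = position (N + 48 * ((i + 1 : ℕ) : ℤ)) := by
      rw [e, ← add_assoc, position_add_mul]
    have e2 : position (N + 48 * k + 1) = position (N + 48 * ((i + 1 : ℕ) : ℤ) + 1) := by
      rw [e, ← add_assoc, add_right_comm, position_add_mul]
    have := position_trichotomy N ⟨i, by omega⟩
    simp only at this
    rw [← e1, ← e2] at this
    rcases this with h | h | ⟨h1, h2, h3⟩
    · exact Or.inl h
    · exact Or.inr (Or.inl h)
    · exact Or.inr (Or.inr ⟨⟨k, rfl⟩, h2, h3, h1⟩)

lemma radius_pos (N : ℤ) {f : ℝ} (hf0 : 0 ≤ f) (hf1 : f ≤ 1) :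
    0 < 1 + ((position N : ℝ) + f * positionStep N) := by
  have h0 : (0 : ℝ) ≤ position N := by exact_mod_cast position_nonneg N
  have h1 : (0 : ℝ) ≤ position (N + 1) := by exact_mod_cast position_nonneg (N + 1)
  rw [positionStep]
  push_cast
  nlinarith

/-- The double points of the projection of the closed braid. -/
lemma braidPiece_proj_eq {N N' : ℤ} {f f' : ℝ} (hf : f ∈ Set.Ico (0 : ℝ) 1)
    (hf' : f' ∈ Set.Ico (0 : ℝ) 1) (h0 : braidPiece N f 0 = braidPiece N' f' 0)
    (h1 : braidPiece N f 1 = braidPiece N' f' 1) :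
    f' = f ∧ ((∃ k, N' = N + 240 * k) ∨ (f = 1 / 2 ∧ IsCrossingPair N N')) := by
  obtain ⟨hr, k, hk⟩ := cylinderPoint_proj_inj (radius_pos N hf.1 hf.2.le)
    (radius_pos N' hf'.1 hf'.2.le) h0 h1
  have hk' : (N : ℝ) + f - (N' + f') = 48 * k := by
    have h2 : 2 * Real.pi * ((N : ℝ) + f - (N' + f')) = 2 * Real.pi * (48 * k) := by
      linear_combination 48 * hk
    exact mul_left_cancel₀ (by positivity) h2
  -- As `|f' - f| < 1`, the integer parts themselves must differ by a multiple of 48.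
  have hN : N - N' = 48 * k := by
    have h3 : ((N - N' - 48 * k : ℤ) : ℝ) = f' - f := by push_cast; linarith
    have h4 : ((N - N' - 48 * k : ℤ) : ℝ) < (1 : ℤ) := by
      rw [h3]; push_cast; linarith [hf.1, hf'.2]
    have h5 : ((-1 : ℤ) : ℝ) < (N - N' - 48 * k : ℤ) := by
      rw [h3]; push_cast; linarith [hf.2, hf'.1]
    have h6 := Int.cast_lt.1 h4
    have h7 := Int.cast_lt.1 h5
    omega
  have hff : f' = f := by
    have h3 : ((N - N' : ℤ) : ℝ) = (48 * k : ℤ) := by rw [hN]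
    push_cast at h3
    linarith
  refine ⟨hff, ?_⟩
  subst hff
  obtain rfl : N' = N + 48 * (-k) := by omega
  have hr' : (1 - f') * position N + f' * position (N + 1)
      = (1 - f') * position (N + 48 * (-k)) + f' * position (N + 48 * (-k) + 1) := by
    simp only [positionStep, Int.cast_sub] at hr
    linear_combination hr
  have g0 := hf.1
  have g1 : 0 < 1 - f' := sub_pos.2 hf.2
  rcases position_cases N (-k) with ⟨m, hm⟩ | ⟨h2, h3⟩ | ⟨h2, h3⟩ | h
  · exact Or.inl ⟨m, by omega⟩
  -- Both radii are averages with the same weights `1 - f'` and `f'`; the first weight is positive,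
  -- so the order persists strictly.
  · have h2' : (position N : ℝ) < position (N + 48 * (-k)) := by exact_mod_cast h2
    have h3' : (position (N + 1) : ℝ) < position (N + 48 * (-k) + 1) := by exact_mod_cast h3
    nlinarith [mul_lt_mul_of_pos_left h2' g1, mul_le_mul_of_nonneg_left h3'.le g0]
  · have h2' : (position (N + 48 * (-k)) : ℝ) < position N := by exact_mod_cast h2
    have h3' : (position (N + 48 * (-k) + 1) : ℝ) < position (N + 1) := by exact_mod_cast h3
    nlinarith [mul_lt_mul_of_pos_left h2' g1, mul_le_mul_of_nonneg_left h3'.le g0]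
  · refine Or.inr ⟨?_, h⟩
    rw [h.2.2.1, ← h.2.1] at hr'
    have h4 : ((position (N + 48 * (-k)) : ℝ) - position N) * (2 * f' - 1) = 0 := by
      linear_combination hr'
    rcases mul_eq_zero.1 h4 with h5 | h5
    · exact absurd (by exact_mod_cast sub_eq_zero.1 h5) h.2.2.2
    · linarith

lemma closureCurve_proj_eq {s t : ℝ} (h0 : braidWW.closureCurve s 0 = braidWW.closureCurve t 0)
    (h1 : braidWW.closureCurve s 1 = braidWW.closureCurve t 1) :
    (∃ m : ℤ, s - t = m) ∨ ∃ N N', IsCrossingPair N N' ∧ s = (N + 1 / 2) / 240 ∧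
      t = (N' + 1 / 2) / 240 := by
  rw [closureCurve_eq_braidPiece_fract s, closureCurve_eq_braidPiece_fract t] at h0 h1
  have hs := Int.floor_add_fract (240 * s)
  have ht := Int.floor_add_fract (240 * t)
  obtain ⟨hf, ⟨k, hk⟩ | ⟨hf2, h⟩⟩ := braidPiece_proj_eq ⟨Int.fract_nonneg _, Int.fract_lt_one _⟩
    ⟨Int.fract_nonneg _, Int.fract_lt_one _⟩ h0 h1
  · refine Or.inl ⟨-k, ?_⟩
    rw [hk, hf] at ht
    push_cast at ht ⊢
    linarith
  · exact Or.inr ⟨_, _, h, by linarith, by linarith⟩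

lemma closureCurve_half (N : ℤ) :
    braidWW.closureCurve ((N + 1 / 2) / 240) = braidPiece N (1 / 2) := by
  rw [closureCurve_eq_braidPiece (N := N) (by linarith) (by linarith)]
  congr 1
  ring

lemma closureCurve_half_height (N : ℤ) :
    braidWW.closureCurve ((N + 1 / 2) / 240) 2 = (letterSign N * positionStep N : ℤ) / 4 := by
  rw [closureCurve_half, braidPiece, cylinderPoint_two]
  push_cast
  ring

theorem isKnot_closureCurve : IsKnot braidWW.closureCurve where
  continuous := continuous_closureCurve
  periodic := periodic_closureCurve
  injective s t h := by
    rcases closureCurve_proj_eq (congrArg (fun p : E3 => p 0) h) (congrArg (fun p : E3 => p 1) h)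
      with h1 | ⟨N, N', h1, rfl, rfl⟩
    · exact h1
    -- At a crossing the two heights are `1/4` and `-1/4`.
    · have h2 := congrArg (fun p : E3 => p 2) h
      simp only [closureCurve_half_height, h1.letterSign_eq, h1.positionStep_eq_neg] at h2
      have h3 : letterSign N * positionStep N = letterSign N * -positionStep N := by
        have := mul_right_cancel₀ (b := (4 : ℝ)⁻¹) (by norm_num) h2
        exact_mod_cast this
      have h4 := mul_ne_zero (letterSign_ne_zero N) h1.positionStep_ne_zero
      rw [mul_neg] at h3
      omega

lemma exists_braidWW_perm_pow (p : Fin 5) : ∃ j : Fin 5, (braidWW.perm ^ (j : ℕ)) 0 = p := by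
  revert p
  decide +kernel

theorem range_closureCurve : Set.range braidWW.closureCurve = braidWW.closure := by
  ext y
  constructor
  · rintro ⟨t, rfl⟩
    exact ⟨_, _, ⟨Int.fract_nonneg _, Int.fract_lt_one _⟩, rfl⟩
  · rintro ⟨p, x, hx, rfl⟩
    obtain ⟨j, rfl⟩ := exists_braidWW_perm_pow p
    refine ⟨((j : ℕ) + x) / 5, ?_⟩
    rw [BraidWord.closureCurve, show ((4 + 1 : ℕ) : ℝ) * (((j : ℕ) + x) / 5) = (j : ℕ) + x by
      push_cast; ring, Int.floor_natCast_add, Int.fract_natCast_add, Int.fract_eq_self.2 hx,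
      Int.floor_eq_zero_iff.2 hx, add_zero, zpow_natCast]

/-! ### Amphicheirality -/

lemma S3.sum_sq (x : S3) : x.1 0 ^ 2 + x.1 1 ^ 2 + x.1 2 ^ 2 + x.1 3 ^ 2 = 1 := by
  have h := x.2
  rw [mem_sphere_zero_iff_norm, EuclideanSpace.norm_eq, Real.sqrt_eq_one] at h
  simpa [Fin.sum_univ_four] using h

/-- The orthogonal map of `S³` which rotates the first two coordinates by the angle `α` and
reflects the last two, evaluated at a point. -/
noncomputable def rotateReflectS3 (α β : ℝ) (x : S3) : S3 :=
  ⟨!₂[Real.cos α * x.1 0 - Real.sin α * x.1 1, Real.sin α * x.1 0 + Real.cos α * x.1 1,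
      Real.sin β * x.1 3 - Real.cos β * x.1 2, Real.sin β * x.1 2 + Real.cos β * x.1 3], by
    rw [mem_sphere_zero_iff_norm, EuclideanSpace.norm_eq, Real.sqrt_eq_one]
    simp only [Real.norm_eq_abs, sq_abs, Fin.sum_univ_four]
    simp only [Matrix.cons_val]
    linear_combination S3.sum_sq x
      + (x.1 0 ^ 2 + x.1 1 ^ 2) * Real.sin_sq_add_cos_sq α
      + (x.1 2 ^ 2 + x.1 3 ^ 2) * Real.sin_sq_add_cos_sq β⟩

lemma continuous_rotateReflectS3 {X : Type*} [TopologicalSpace X] {α β : X → ℝ} {g : X → S3}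
    (hα : Continuous α) (hβ : Continuous β) (hg : Continuous g) :
    Continuous fun x => rotateReflectS3 (α x) (β x) (g x) := by
  refine Continuous.subtype_mk ?_ _
  refine (PiLp.continuous_toLp 2 _).comp (continuous_pi fun i => ?_)
  fin_cases i <;> simp <;> fun_prop

/-- The reflection part is an involution, so only the rotation angle is negated. -/
lemma rotateReflectS3_neg (α β : ℝ) (x : S3) :
    rotateReflectS3 (-α) β (rotateReflectS3 α β x) = x := by
  have h1 := Real.sin_sq_add_cos_sq α
  have h2 := Real.sin_sq_add_cos_sq β
  ext i
  fin_cases i <;> simp [rotateReflectS3]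
  · linear_combination x.1 0 * h1
  · linear_combination x.1 1 * h1
  · linear_combination x.1 2 * h2
  · linear_combination x.1 3 * h2

/-- The orthogonal maps `rotateReflectS3 α β` as homeomorphisms. -/
noncomputable def rotateReflectHomeomorph (α β : ℝ) : S3 ≃ₜ S3 where
  toFun := rotateReflectS3 α β
  invFun := rotateReflectS3 (-α) β
  left_inv := rotateReflectS3_neg α β
  right_inv x := by simpa using rotateReflectS3_neg (-α) β x
  continuous_toFun := continuous_rotateReflectS3 continuous_const continuous_const continuous_id
  continuous_invFun := continuous_rotateReflectS3 continuous_const continuous_const continuous_id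

/-- Move `α` to 0 and `β` to `π` through orthogonal maps of the same form; at `β = π` the reflection
negates exactly the last coordinate. -/
lemma orientationReversing_rotateReflectHomeomorph (α β : ℝ) :
    OrientationReversing (rotateReflectHomeomorph α β) :=
  ⟨{  toFun := fun p => rotateReflectS3 ((1 - (p.1 : ℝ)) * α)
        ((1 - (p.1 : ℝ)) * β + p.1 * Real.pi) p.2
      continuous_toFun := continuous_rotateReflectS3 (by fun_prop) (by fun_prop) (by fun_prop)
      map_zero_left := fun x => by
        simp [rotateReflectHomeomorph]
      map_one_left := fun x => by
        ext i
        fin_cases i <;> simp [rotateReflectS3, reflectS3] }⟩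

lemma norm_quarterTurn (p : E3) : ‖quarterTurn p‖ = ‖p‖ := by
  simp only [EuclideanSpace.norm_eq, Fin.sum_univ_three, quarterTurn]
  simp [add_comm]

/-- The quarter turn preserves the norm, so on `S³` it acts on the first three coordinates and fixes
the last. -/
lemma rotateReflectS3_toS3 (p : E3) :
    rotateReflectS3 (Real.pi / 2) 0 (toS3 p) = toS3 (quarterTurn p) := by
  ext i
  simp only [toS3, norm_quarterTurn]
  fin_cases i <;> simp [rotateReflectS3, quarterTurn, neg_div]

theorem positiveAmphicheiral_closureCurve :
    PositiveAmphicheiral (toS3 ∘ braidWW.closureCurve) :=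
  ⟨rotateReflectHomeomorph (Real.pi / 2) 0, orientationReversing_rotateReflectHomeomorph _ _,
    OrderIso.addRight (1 / 4), fun t => by
      rw [OrderIso.addRight_apply, Function.comp_apply, Function.comp_apply,
        closureCurve_add_quarter]
      exact rotateReflectS3_toS3 _⟩

theorem PositiveAmphicheiral.amphicheiral {γ : ℝ → S3} (h : PositiveAmphicheiral γ) :
    Amphicheiral γ := by
  obtain ⟨h, hh, φ, hφ⟩ := h
  refine ⟨h, hh, ?_⟩
  rw [← Set.range_comp, show h ∘ γ = γ ∘ φ from funext hφ, φ.surjective.range_comp]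

/-! ### The diagram -/

/-- The letters at which the underpasses occur. -/
def underLetter (k : Fin 48) : ℕ :=
  [1, 3, 6, 10, 21, 26, 33, 35, 42, 48, 52, 53, 60, 64, 68, 71, 80, 87, 89, 91, 94, 103, 109,
    110].getD (k % 24) 0 + 120 * (k / 24)

/-- The letters at which the corresponding overpasses occur. -/
def overLetter (k : Fin 48) : ℕ :=
  ([49, 147, 102, 154, 213, 170, 81, 131, 186, 0, 4, 149, 108, 112, 20, 215, 128, 183, 233, 43,
    190, 151, 61, 206].getD (k % 24) 0 + 120 * (k / 24)) % 240

/-- The index of the arc that contains the overpass. -/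
def overIndex (k : Fin 48) : Fin 48 :=
  ⟨([10, 30, 21, 31, 44, 34, 17, 28, 38, 0, 2, 30, 22, 24, 4, 45, 27, 37, 0, 9, 39, 30, 13,
    41].getD (k % 24) 0 + 24 * (k / 24)) % 48,
    Nat.mod_lt _ (by norm_num)⟩

lemma underLetter_lt (k : Fin 48) : underLetter k < 240 := by
  revert k; decide +kernel

lemma overLetter_lt (k : Fin 48) : overLetter k < 240 := Nat.mod_lt _ (by norm_num)

lemma underLetter_lt_succ (k : Fin 47) : underLetter k.castSucc < underLetter k.succ := by
  revert k; decide +kernel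

lemma strictMono_underLetter : StrictMono underLetter :=
  Fin.strictMono_iff_lt_succ.2 underLetter_lt_succ

/-- The tables list 24 crossings and repeat them 120 letters later: the square of the quarter-turn
symmetry preserves heights, hence under- and overpasses. -/
lemma isCrossingPair_letters (k : Fin 48) :
    IsCrossingPair (underLetter k) (overLetter k) := by
  have h1 : ∀ k : Fin 48, overLetter k % 48 = underLetter k % 48 := by decide +kernel
  have h2 : ∀ k : Fin 48, position (overLetter k) = position (underLetter k + 1) ∧
    position (overLetter k + 1) = position (underLetter k) ∧
    position (overLetter k) ≠ position (underLetter k) := by decide +kernel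
  refine ⟨⟨((overLetter k : ℤ) - underLetter k) / 48, ?_⟩, h2 k⟩
  have := h1 k
  omega

lemma letterSign_mul_positionStep_underLetter (k : Fin 48) :
    letterSign (underLetter k) * positionStep (underLetter k) = -1 := by
  revert k; decide +kernel

lemma letterSign_mul_positionStep_overLetter (k : Fin 48) :
    letterSign (overLetter k) * positionStep (overLetter k) = 1 := by
  rw [(isCrossingPair_letters k).letterSign_eq, (isCrossingPair_letters k).positionStep_eq_neg,
    mul_neg, letterSign_mul_positionStep_underLetter, neg_neg]

lemma exists_underLetter_eq {N : ℕ} (hN : N < 240)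
    (h : letterSign N * positionStep N = -1) : ∃ k, underLetter k = N := by
  have : ∀ i : Fin 240, letterSign (i : ℕ) * positionStep (i : ℕ) = -1 →
    ∃ k, underLetter k = i := by decide +kernel
  exact this ⟨N, hN⟩ h

lemma letterSign_mul_positionStep (N : ℤ) :
    letterSign N * positionStep N = -1 ∨ letterSign N * positionStep N = 0 ∨
      letterSign N * positionStep N = 1 := by
  have h2 : ∀ N : ℤ, positionStep N = -1 ∨ positionStep N = 0 ∨ positionStep N = 1 :=
    forall_int_of_forall_fin (n := 60)
      (fun N h => by rwa [Nat.cast_ofNat, positionStep_emod] at h) (by decide +kernel)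
  rcases letterSign_eq N with h | h <;> rcases h2 N with h' | h' | h' <;> simp [h, h']

/-- A letter takes part in at most one crossing. -/
lemma IsCrossingPair.unique {N M M' : ℤ} (h : IsCrossingPair N M) (h' : IsCrossingPair N M')
    (hM : 0 ≤ M ∧ M < 240) (hM' : 0 ≤ M' ∧ M' < 240) : M = M' := by
  obtain ⟨⟨k, hk⟩, h1, -⟩ := h
  obtain ⟨⟨k', hk'⟩, h1', -⟩ := h'
  obtain ⟨m, rfl⟩ : ∃ m, M' = M + 48 * m := ⟨k' - k, by omega⟩
  rw [← h1'] at h1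
  -- Both partners start the same sector in the position `position (N + 1)`, whereas different
  -- strands have different positions there.
  rcases position_cases M m with ⟨a, ha⟩ | h | h | h
  · omega
  · omega
  · omega
  · exact absurd h1.symm h.2.2.2

lemma exists_crossing_of_isCrossingPair {N M : ℤ} (h : IsCrossingPair N M)
    (hN : 0 ≤ N ∧ N < 240) (hM : 0 ≤ M ∧ M < 240) :
    ∃ k, (N = underLetter k ∧ M = overLetter k) ∨ (N = overLetter k ∧ M = underLetter k) := by
  have key : ∀ N M : ℤ, IsCrossingPair N M → (0 ≤ N ∧ N < 240) → (0 ≤ M ∧ M < 240) →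
      letterSign N * positionStep N = -1 → ∃ k, N = underLetter k ∧ M = overLetter k := by
    intro N M h hN hM h1
    obtain ⟨n, rfl⟩ := Int.eq_ofNat_of_zero_le hN.1
    obtain ⟨k, rfl⟩ := exists_underLetter_eq (by omega) h1
    have := overLetter_lt k
    exact ⟨k, rfl, h.unique (isCrossingPair_letters k) hM (by omega)⟩
  rcases letterSign_mul_positionStep N with h1 | h1 | h1
  · obtain ⟨k, hk⟩ := key N M h hN hM h1
    exact ⟨k, Or.inl hk⟩
  · exact absurd h1 (mul_ne_zero (letterSign_ne_zero N) h.positionStep_ne_zero)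
  · obtain ⟨k, hk⟩ := key M N h.symm hM hN (by
      rw [h.letterSign_eq, h.positionStep_eq_neg, mul_neg, h1])
    exact ⟨k, Or.inr hk.symm⟩

/-! ### Velocities and signs at the crossings. -/

/-- The parameter of the midpoint of a letter. -/
noncomputable def letterParam (n : ℕ) : ℝ := ((n : ℤ) + 1 / 2) / 240

lemma letterParam_mem {n : ℕ} (hn : n < 240) : letterParam n ∈ Set.Ico (0 : ℝ) 1 := by
  have : (n : ℝ) + 1 ≤ 240 := by exact_mod_cast hn
  constructor
  · rw [letterParam]
    positivity
  · rw [letterParam, div_lt_one (by norm_num), Int.cast_natCast]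
    linarith

lemma letterParam_lt_letterParam {m n : ℕ} : letterParam m < letterParam n ↔ m < n := by
  rw [letterParam, letterParam, div_lt_div_iff_of_pos_right (by norm_num)]
  simp

lemma closureCurve_letterParam_height (n : ℕ) :
    braidWW.closureCurve (letterParam n) 2 = (letterSign n * positionStep n : ℤ) / 4 :=
  closureCurve_half_height n

lemma hasDerivAt_cylinderPoint_zero {r θ z : ℝ → ℝ} {r' θ' x : ℝ} (hr : HasDerivAt r r' x)
    (hθ : HasDerivAt θ θ' x) :
    HasDerivAt (fun t => cylinderPoint (r t) (θ t) (z t) 0)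
      (r' * Real.cos (θ x) - r x * θ' * Real.sin (θ x)) x := by
  convert! hr.mul hθ.cos using 1
  ring

lemma hasDerivAt_cylinderPoint_one {r θ z : ℝ → ℝ} {r' θ' x : ℝ} (hr : HasDerivAt r r' x)
    (hθ : HasDerivAt θ θ' x) :
    HasDerivAt (fun t => cylinderPoint (r t) (θ t) (z t) 1)
      (r' * Real.sin (θ x) + r x * θ' * Real.cos (θ x)) x := by
  convert! hr.mul hθ.sin using 1
  ring

lemma deriv_apply_of_differentiableAt {γ : ℝ → E3} {x : ℝ} (h : DifferentiableAt ℝ γ x)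
    (i : Fin 3) : deriv γ x i = deriv (fun t => γ t i) x := by
  have h1 : HasDerivAt (fun t => γ t i) (deriv γ x i) x :=
    ((EuclideanSpace.proj (𝕜 := ℝ) i).hasFDerivAt (x := γ x)).comp_hasDerivAt x h.hasDerivAt
  exact h1.deriv.symm

lemma deriv_closureCurve_letterParam (n : ℕ) :
    deriv braidWW.closureCurve (letterParam n) 0
      = 240 * positionStep n * Real.cos (2 * Real.pi * ((n + 1 / 2) / 48))
        - (1 + (position n + 1 / 2 * positionStep n)) * (10 * Real.pi)
          * Real.sin (2 * Real.pi * ((n + 1 / 2) / 48)) ∧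
    deriv braidWW.closureCurve (letterParam n) 1
      = 240 * positionStep n * Real.sin (2 * Real.pi * ((n + 1 / 2) / 48))
        + (1 + (position n + 1 / 2 * positionStep n)) * (10 * Real.pi)
          * Real.cos (2 * Real.pi * ((n + 1 / 2) / 48)) := by
  have hx : 240 * letterParam n - n = 1 / 2 := by
    rw [letterParam]
    push_cast
    ring
  have hev : braidWW.closureCurve =ᶠ[nhds (letterParam n)]
      fun t => braidPiece n (240 * t - n) := by
    have hopen : IsOpen {t : ℝ | 240 * t ∈ Set.Ioo (n : ℝ) (n + 1)} :=
      isOpen_Ioo.preimage (continuous_const_mul (240 : ℝ))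
    filter_upwards [hopen.mem_nhds ⟨by linarith, by linarith⟩] with t ht
    exact closureCurve_eq_braidPiece (N := n) (by simpa using ht.1.le) (by simpa using ht.2.le)
  have hr : HasDerivAt (fun t : ℝ => 1 + ((position n : ℝ) + (240 * t - n) * positionStep n))
      (240 * positionStep n) (letterParam n) := by
    simpa using (((((hasDerivAt_id (letterParam n)).const_mul 240).sub_const (n : ℝ)).mul_const
      (positionStep n : ℝ)).const_add (position n : ℝ)).const_add 1
  -- The angular velocity is `10π`: five turns per period.
  have hθ : HasDerivAt (fun t : ℝ => 2 * Real.pi * (((n : ℤ) + (240 * t - n)) / 48))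
      (10 * Real.pi) (letterParam n) := by
    have h := (((((hasDerivAt_id (letterParam n)).const_mul 240).sub_const (n : ℝ)).const_add
      ((n : ℤ) : ℝ)).div_const 48).const_mul (2 * Real.pi)
    convert! h using 1
    ring
  have hd : DifferentiableAt ℝ (fun t => braidPiece n (240 * t - n)) (letterParam n) := by
    rw [differentiableAt_euclidean]
    intro i
    fin_cases i
    · exact (hasDerivAt_cylinderPoint_zero hr hθ).differentiableAt
    · exact (hasDerivAt_cylinderPoint_one hr hθ).differentiableAt
    · simp only [braidPiece, Fin.reduceFinMk, cylinderPoint_two]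
      fun_prop
  rw [hev.deriv_eq, deriv_apply_of_differentiableAt hd, deriv_apply_of_differentiableAt hd]
  have h0 := (hasDerivAt_cylinderPoint_zero (z := fun t =>
    letterSign n * positionStep n * ((240 * t - n) * (1 - (240 * t - n)))) hr hθ).deriv
  have h1 := (hasDerivAt_cylinderPoint_one (z := fun t =>
    letterSign n * positionStep n * ((240 * t - n) * (1 - (240 * t - n)))) hr hθ).deriv
  simp only [hx, Int.cast_natCast] at h0 h1
  exact ⟨h0, h1⟩

/-- In the radial and tangential frame the velocities are `(d, v)` above and `(-d, v)` below, with
determinant `2dv`; here `d = 240 * positionStep n` and `v` is the radius times `10π`. -/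
lemma crossDet_letterParam {m n : ℕ} (h : IsCrossingPair m n) :
    crossDet braidWW.closureCurve (letterParam n) (letterParam m)
      = 480 * (1 + (position n + 1 / 2 * positionStep n)) * (10 * Real.pi)
        * positionStep n := by
  obtain ⟨k, hk⟩ := h.1
  have hk' : (n : ℝ) = m + 48 * k := by exact_mod_cast hk
  have hp : (position m : ℝ) + 1 / 2 * positionStep m
      = position n + 1 / 2 * positionStep n := by
    rw [h.positionStep_eq_neg, h.2.1, positionStep]
    push_cast
    ring
  have hd : (positionStep m : ℝ) = -positionStep n := by
    rw [h.positionStep_eq_neg]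
    push_cast
    ring
  obtain ⟨d0, d1⟩ := deriv_closureCurve_letterParam n
  obtain ⟨e0, e1⟩ := deriv_closureCurve_letterParam m
  rw [show 2 * Real.pi * (((n : ℝ) + 1 / 2) / 48)
    = 2 * Real.pi * (((m : ℝ) + 1 / 2) / 48) + k * (2 * Real.pi) by rw [hk']; ring,
    Real.cos_add_int_mul_two_pi, Real.sin_add_int_mul_two_pi] at d0 d1
  rw [hp, hd] at e0 e1
  rw [crossDet, d0, d1, e0, e1]
  linear_combination 480 * (1 + ((position n : ℝ) + 1 / 2 * positionStep n)) * (10 * Real.pi)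
        * positionStep n * Real.sin_sq_add_cos_sq (2 * Real.pi * (((m : ℝ) + 1 / 2) / 48))

lemma sign_crossDet_letterParam {m n : ℕ} (h : IsCrossingPair m n) :
    SignType.sign (crossDet braidWW.closureCurve (letterParam n) (letterParam m))
      = SignType.sign (positionStep n) := by
  have h1 : 0 < 1 + ((position n : ℝ) + 1 / 2 * positionStep n) :=
    radius_pos n (by norm_num) (by norm_num)
  rw [crossDet_letterParam h, sign_mul, sign_pos (by positivity), one_mul, sign_intCast]

/-- On the overpass letter sign and step multiply to 1, so the sign of the step is the letter sign.
-/
lemma crossingSign_letterParam (k : Fin 48) :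
    crossingSign braidWW.closureCurve (fun k => letterParam (underLetter k))
      (fun k => letterParam (overLetter k)) k = letterSign (underLetter k) := by
  rw [crossingSign, sign_crossDet_letterParam (isCrossingPair_letters k),
    ← (isCrossingPair_letters k).letterSign_eq]
  have := letterSign_mul_positionStep_overLetter k
  rcases Int.mul_eq_one_iff_eq_one_or_neg_one.1 this with ⟨h1, h2⟩ | ⟨h1, h2⟩ <;>
    simp [h1, h2]

lemma overArc_letterParam (k : Fin 48) :
    overArc (fun k => letterParam (underLetter k)) (fun k => letterParam (overLetter k)) k
      = overIndex k := by
  have : ∀ k, Fin.ofNat 48 (Fintype.card {i : Fin 48 // underLetter i < overLetter k})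
    = overIndex k := by decide +kernel
  rw [overArc, ← this k]
  simp only [letterParam_lt_letterParam, Nat.card_eq_fintype_card]

theorem isDiagram_closureCurve : IsDiagram braidWW.closureCurve
    (fun k => letterParam (underLetter k)) (fun k => letterParam (overLetter k)) where
  under_mem k := letterParam_mem (underLetter_lt k)
  over_mem k := letterParam_mem (overLetter_lt k)
  strictMono k l h := letterParam_lt_letterParam.2 (strictMono_underLetter h)
  proj_eq k := by
    obtain ⟨⟨j, hj⟩, h1, h2, -⟩ := isCrossingPair_letters k
    rw [letterParam, letterParam, closureCurve_half, closureCurve_half, braidPiece, braidPiece,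
      show 2 * Real.pi * ((((overLetter k : ℤ) : ℝ) + 1 / 2) / 48)
        = 2 * Real.pi * ((((underLetter k : ℤ) : ℝ) + 1 / 2) / 48) + j * (2 * Real.pi) by
      rw [hj]; push_cast; ring, cylinderPoint_add_int_mul_two_pi, positionStep, positionStep,
      h1, h2]
    simp only [cylinderPoint_zero, cylinderPoint_one]
    push_cast
    constructor <;> ring
  height_lt k := by
    rw [closureCurve_letterParam_height, closureCurve_letterParam_height,
      letterSign_mul_positionStep_underLetter, letterSign_mul_positionStep_overLetter]
    norm_num
  exhaustive s hs t ht h0 h1 := by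
    rcases closureCurve_proj_eq h0 h1 with ⟨m, hm⟩ | ⟨N, M, h, rfl, rfl⟩
    · refine Or.inl ?_
      have h2 : (m : ℝ) < (1 : ℤ) := by rw [← hm]; push_cast; linarith [hs.2, ht.1]
      have h3 : ((-1 : ℤ) : ℝ) < m := by rw [← hm]; push_cast; linarith [hs.1, ht.2]
      have h4 := Int.cast_lt.1 h2
      have h5 := Int.cast_lt.1 h3
      obtain rfl : m = 0 := by omega
      push_cast at hm
      linarith
    · have bound : ∀ N : ℤ, ((N : ℝ) + 1 / 2) / 240 ∈ Set.Ico (0 : ℝ) 1 → 0 ≤ N ∧ N < 240 := by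
        rintro N ⟨a, b⟩
        rw [div_lt_one (by norm_num)] at b
        rw [le_div_iff₀ (by norm_num)] at a
        have h2 : ((-1 : ℤ) : ℝ) < N := by push_cast; linarith
        have h3 : (N : ℝ) < (240 : ℤ) := by push_cast; linarith
        have h4 := Int.cast_lt.1 h2
        have h5 := Int.cast_lt.1 h3
        omega
      obtain ⟨k, ⟨rfl, rfl⟩ | ⟨rfl, rfl⟩⟩ :=
        exists_crossing_of_isCrossingPair h (bound N hs) (bound M ht)
      · exact Or.inr ⟨k, Or.inl ⟨rfl, rfl⟩⟩
      · exact Or.inr ⟨k, Or.inr ⟨rfl, rfl⟩⟩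
  transverse k := by
    rw [← sign_ne_zero, sign_crossDet_letterParam (isCrossingPair_letters k), sign_ne_zero]
    exact (isCrossingPair_letters k).symm.positionStep_ne_zero

lemma AmbientIsotopic.refl (γ : ℝ → E3) : AmbientIsotopic γ γ :=
  ⟨fun _ => Homeomorph.refl E3, continuous_snd, fun _ => rfl, fun _ => rfl⟩

/-! ### Determinants by elimination -/

namespace Matrix

variable {R : Type*} [CommRing R] {ι κ : Type*} [Fintype ι] [DecidableEq ι] [Fintype κ]
  [DecidableEq κ]

lemma det_eq_prod_diag_of_injective (M : Matrix ι ι R) (b : ι → ℕ) (hb : Function.Injective b)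
    (h : ∀ i j, b i < b j → M i j = 0) : M.det = ∏ i, M i i := by
  let _ : LinearOrder ι := LinearOrder.lift' b hb
  have h1 : M.BlockTriangular OrderDual.toDual := fun i j hij => h i j hij
  convert! det_of_isLowerTriangular M h1

/-- Elimination of the unknowns outside the range of `s`: the columns of `Y` solve the equations
outside this range, and restrict to the standard basis on it. -/
lemma det_eq_det_mul_prod (M : Matrix ι ι R) (s : κ → ι) (hs : Function.Injective s)
    (p : ι → Prop) [DecidablePred p] (hp : ∀ i, p i ↔ i ∈ Set.range s) (b : ι → ℕ)
    (hb : Function.Injective b) (Y : Matrix ι κ R) (hY : ∀ i j, Y (s i) j = (1 : Matrix κ κ R) i j)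
    (hMY : ∀ i, ¬p i → ∀ j, (M * Y) i j = 0)
    (htri : ∀ i j, ¬p i → ¬p j → b i < b j → M i j = 0) :
    M.det = ((M * Y).submatrix s id).det * ∏ i : {i // ¬p i}, M i i := by
  let e : κ ≃ {i // p i} :=
    (Equiv.ofInjective s hs).trans (Equiv.subtypeEquivRight fun i => (hp i).symm)
  have he : ∀ k, (e k : ι) = s k := fun k => rfl
  have hps : ∀ k, p (s k) := fun k => (e k).2
  have hes : ∀ k, e.symm ⟨s k, hps k⟩ = k := fun k => e.symm_apply_apply k
  -- Replacing the columns of the identity in the range of `s` by those of `Y` gives a unimodular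
  -- `Q`, and `M * Q` is block triangular.
  let Q : Matrix ι ι R :=
    of fun i j => if h : p j then Y i (e.symm ⟨j, h⟩) else (1 : Matrix ι ι R) i j
  have hMQ : ∀ i j, (M * Q) i j = if h : p j then (M * Y) i (e.symm ⟨j, h⟩) else M i j := by
    intro i j
    by_cases h : p j
    · simp [mul_apply, Q, h]
    · rw [dif_neg h]
      conv_rhs => rw [← Matrix.mul_one M]
      simp only [mul_apply, Q, h, of_apply, dite_false]
  have hQ : Q.det = 1 := by
    rw [twoBlockTriangular_det' Q p]
    · have h1 : toSquareBlockProp Q p = 1 := by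
        ext i j
        obtain ⟨i, rfl⟩ := e.surjective i
        obtain ⟨j, rfl⟩ := e.surjective j
        have : Q (e i) (e j) = Y (s i) j := by
          simp [Q, he, hps, hes]
        rw [toSquareBlockProp_def, of_apply, this, hY]
        simp [one_apply]
      have h2 : (toSquareBlockProp Q fun i => ¬p i) = 1 := by
        ext i j
        simp [toSquareBlockProp_def, Q, j.2, one_apply, Subtype.ext_iff]
      rw [h1, h2, det_one, det_one, mul_one]
    · intro i hi j hj
      have : i ≠ j := fun h => hj (h ▸ hi)
      simp [Q, hj, one_apply, this]
  rw [← mul_one M.det, ← hQ, ← det_mul, twoBlockTriangular_det (M * Q) p]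
  · congr 1
    · rw [← det_submatrix_equiv_self e]
      congr 1
      ext i j
      simp only [submatrix_apply, toSquareBlockProp_def, of_apply, hMQ, he, hps, hes,
        dite_true, id]
    · have h3 : (toSquareBlockProp (M * Q) fun i => ¬p i)
          = M.submatrix Subtype.val Subtype.val := by
        ext i j
        rw [toSquareBlockProp_def, of_apply, hMQ, dif_neg j.2, submatrix_apply]
      rw [h3]
      exact det_eq_prod_diag_of_injective (M.submatrix Subtype.val Subtype.val)
        (fun i : {i // ¬p i} => b i) (hb.comp Subtype.val_injective)
        fun i j hij => htri i j i.2 j.2 hij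
  · intro i hi j hj
    rw [hMQ, dif_pos hj, hMY i hi]

end Matrix

/-! ### Computation with Laurent polynomials -/

/-- Addition of coefficient lists. -/
def coeffAdd : List ℤ → List ℤ → List ℤ
  | [], l => l
  | l, [] => l
  | a :: l, b :: m => (a + b) :: coeffAdd l m

/-- Multiplication of coefficient lists. -/
def coeffMul : List ℤ → List ℤ → List ℤ
  | [], _ => []
  | a :: l, m => coeffAdd (m.map (a * ·)) (0 :: coeffMul l m)

/-- A Laurent polynomial in `t`, given by a natural number `d` and the coefficients of its product
with `t ^ d`. -/
structure LaurentList where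
  /-- the bound for the order of the pole -/
  pole : ℕ
  /-- the coefficients -/
  coeffs : List ℤ

namespace LaurentList

/-- Raise the bound for the order of the pole. -/
def shift (n : ℕ) (l : List ℤ) : List ℤ := List.replicate n 0 ++ l

instance : Add LaurentList where
  add a b :=
    if a.pole ≤ b.pole then ⟨b.pole, coeffAdd (shift (b.pole - a.pole) a.coeffs) b.coeffs⟩
    else ⟨a.pole, coeffAdd a.coeffs (shift (a.pole - b.pole) b.coeffs)⟩

instance : Neg LaurentList where
  neg a := ⟨a.pole, a.coeffs.map fun x => -x⟩

instance : Sub LaurentList where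
  sub a b := a + -b

instance : Mul LaurentList where
  mul a b := ⟨a.pole + b.pole, coeffMul a.coeffs b.coeffs⟩

/-- The constant Laurent polynomials. -/
def const (n : ℤ) : LaurentList := ⟨0, [n]⟩

/-- Multiplication by `t`. -/
def mulT : LaurentList → LaurentList
  | ⟨0, l⟩ => ⟨0, 0 :: l⟩
  | ⟨n + 1, l⟩ => ⟨n, l⟩

/-- Division by `t`. -/
def divT (a : LaurentList) : LaurentList := ⟨a.pole + 1, a.coeffs⟩

/-- Whether all coefficients vanish. -/
def isZero (a : LaurentList) : Bool := a.coeffs.all (· == 0)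

variable {R : Type*} [CommRing R] (u : Rˣ)

/-- The value of a coefficient list. -/
def evalCoeffs : List ℤ → R
  | [] => 0
  | a :: l => a + u * evalCoeffs l

/-- The value at a unit. -/
def eval (a : LaurentList) : R := (u⁻¹ ^ a.pole : Rˣ) * evalCoeffs u a.coeffs

lemma evalCoeffs_add (l m : List ℤ) :
    evalCoeffs u (coeffAdd l m) = evalCoeffs u l + evalCoeffs u m := by
  induction l generalizing m with
  | nil => simp [coeffAdd, evalCoeffs]
  | cons a l ih =>
    cases m with
    | nil => simp [coeffAdd, evalCoeffs]
    | cons b m =>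
      simp only [coeffAdd, evalCoeffs, ih]
      push_cast
      ring

lemma evalCoeffs_map_mul (a : ℤ) (l : List ℤ) :
    evalCoeffs u (l.map (a * ·)) = a * evalCoeffs u l := by
  induction l with
  | nil => simp [evalCoeffs]
  | cons b l ih =>
    simp only [List.map_cons, evalCoeffs, ih]
    push_cast
    ring

lemma evalCoeffs_mul (l m : List ℤ) :
    evalCoeffs u (coeffMul l m) = evalCoeffs u l * evalCoeffs u m := by
  induction l with
  | nil => simp [coeffMul, evalCoeffs]
  | cons a l ih =>
    simp only [coeffMul, evalCoeffs_add, evalCoeffs_map_mul, evalCoeffs, ih]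
    push_cast
    ring

lemma evalCoeffs_shift (n : ℕ) (l : List ℤ) :
    evalCoeffs u (shift n l) = (u ^ n : Rˣ) * evalCoeffs u l := by
  induction n with
  | zero => simp [shift]
  | succ n ih =>
    rw [shift, List.replicate_succ, List.cons_append, evalCoeffs, ← shift, ih]
    push_cast
    ring

lemma evalCoeffs_eq_zero {l : List ℤ} (h : l.all (· == 0) = true) : evalCoeffs u l = 0 := by
  induction l with
  | nil => rfl
  | cons a l ih =>
    rw [List.all_cons, Bool.and_eq_true, beq_iff_eq] at h
    rw [evalCoeffs, h.1, ih h.2]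
    simp

lemma inv_pow_mul_evalCoeffs_shift {m n : ℕ} (h : m ≤ n) (l : List ℤ) :
    ((u⁻¹ ^ n : Rˣ) : R) * evalCoeffs u (shift (n - m) l)
      = (u⁻¹ ^ m : Rˣ) * evalCoeffs u l := by
  rw [evalCoeffs_shift, ← mul_assoc, ← Units.val_mul]
  congr 2
  rw [inv_pow, inv_pow, inv_mul_eq_iff_eq_mul, eq_mul_inv_iff_mul_eq, ← pow_add,
    Nat.sub_add_cancel h]

@[simp] lemma eval_add (a b : LaurentList) : eval u (a + b) = eval u a + eval u b := by
  change eval u (if _ then _ else _) = _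
  split_ifs with h
  · rw [eval, evalCoeffs_add, mul_add, inv_pow_mul_evalCoeffs_shift u h]
    rfl
  · rw [eval, evalCoeffs_add, mul_add, inv_pow_mul_evalCoeffs_shift u (le_of_not_ge h)]
    rfl

@[simp] lemma eval_neg (a : LaurentList) : eval u (-a) = -eval u a := by
  change ((u⁻¹ ^ a.pole : Rˣ) : R) * evalCoeffs u (a.coeffs.map fun x => -x) = _
  rw [show (fun x : ℤ => -x) = fun x => -1 * x by ext; ring, evalCoeffs_map_mul, eval]
  push_cast
  ring

@[simp] lemma eval_sub (a b : LaurentList) : eval u (a - b) = eval u a - eval u b := by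
  change eval u (a + -b) = _
  rw [eval_add, eval_neg, sub_eq_add_neg]

@[simp] lemma eval_mul (a b : LaurentList) : eval u (a * b) = eval u a * eval u b := by
  change ((u⁻¹ ^ (a.pole + b.pole) : Rˣ) : R) * evalCoeffs u (coeffMul a.coeffs b.coeffs) = _
  rw [evalCoeffs_mul, pow_add, Units.val_mul, eval, eval]
  ring

@[simp] lemma eval_const (n : ℤ) : eval u (const n) = n := by
  simp [eval, const, evalCoeffs]

@[simp] lemma eval_mulT (a : LaurentList) : eval u a.mulT = u * eval u a := by
  obtain ⟨n, l⟩ := a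
  cases n with
  | zero => simp [eval, mulT, evalCoeffs]
  | succ n => simp [eval, mulT, pow_succ', ← mul_assoc]

@[simp] lemma eval_divT (a : LaurentList) : eval u a.divT = (u⁻¹ : Rˣ) * eval u a := by
  simp only [eval, divT, pow_succ', Units.val_mul]
  ring

/-- A Laurent polynomial has many such lists, so identities are checked by testing a difference for
zero, which the kernel can evaluate. -/
lemma eval_eq_zero {a : LaurentList} (h : a.isZero = true) : eval u a = 0 := by
  rw [eval, evalCoeffs_eq_zero u h, mul_zero]

/-- The determinant of a matrix with four rows, expanded along its first two rows. -/
def detFour {A : Type*} [Add A] [Sub A] [Mul A] (M : Fin 4 → Fin 4 → A) : A :=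
  (M 0 0 * M 1 1 - M 0 1 * M 1 0) * (M 2 2 * M 3 3 - M 2 3 * M 3 2)
    - (M 0 0 * M 1 2 - M 0 2 * M 1 0) * (M 2 1 * M 3 3 - M 2 3 * M 3 1)
    + (M 0 0 * M 1 3 - M 0 3 * M 1 0) * (M 2 1 * M 3 2 - M 2 2 * M 3 1)
    + (M 0 1 * M 1 2 - M 0 2 * M 1 1) * (M 2 0 * M 3 3 - M 2 3 * M 3 0)
    - (M 0 1 * M 1 3 - M 0 3 * M 1 1) * (M 2 0 * M 3 2 - M 2 2 * M 3 0)
    + (M 0 2 * M 1 3 - M 0 3 * M 1 2) * (M 2 0 * M 3 1 - M 2 1 * M 3 0)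

lemma det_eq_detFour (M : Matrix (Fin 4) (Fin 4) R) :
    M.det = detFour fun i j => M i j := by
  rw [Matrix.det_succ_row_zero]
  simp [Matrix.det_fin_three, Fin.sum_univ_four, detFour, Fin.succAbove]
  ring

lemma eval_detFour (M : Fin 4 → Fin 4 → LaurentList) :
    eval u (detFour M) = detFour fun i j => eval u (M i j) := by
  simp [detFour]

end LaurentList

/-! ### The Conway polynomial -/

open LaurentPolynomial

/-- The Alexander matrix of a diagram with the overpass arcs `a` and the crossing signs `ε`, with
`u` in place of `t`. -/
def wirtingerMatrix {R : Type*} [CommRing R] (u : Rˣ) {n : ℕ} (a : Fin (n + 1) → Fin (n + 1))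
    (ε : Fin (n + 1) → ℤ) : Matrix (Fin (n + 1)) (Fin (n + 1)) R :=
  Matrix.of fun k =>
    Pi.single (a k) (1 - ((u ^ ε k : Rˣ) : R)) + Pi.single k ((u ^ ε k : Rˣ) : R)
      - Pi.single (k + 1) 1

/-- The unit `t` of the Laurent polynomials in `t ^ (1/2)`. -/
noncomputable def laurentT : (LaurentPolynomial ℤ)ˣ where
  val := T 2
  inv := T (-2)
  val_inv := by rw [← T_add]; simp
  inv_val := by rw [← T_add]; simp

lemma coe_laurentT_zpow {e : ℤ} (he : e = 1 ∨ e = -1) :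
    ((laurentT ^ e : (LaurentPolynomial ℤ)ˣ) : LaurentPolynomial ℤ) = T (2 * e) := by
  rcases he with rfl | rfl
  · simp [laurentT]
  · rw [zpow_neg_one]
    rfl

lemma alexanderMatrix_closureCurve :
    alexanderMatrix braidWW.closureCurve (fun k => letterParam (underLetter k))
      (fun k => letterParam (overLetter k))
    = wirtingerMatrix laurentT overIndex fun k => letterSign (underLetter k) := by
  rw [alexanderMatrix, wirtingerMatrix]
  congr 1
  funext k
  rw [overArc_letterParam, crossingSign_letterParam, coe_laurentT_zpow (letterSign_eq _)]

section

variable {R : Type*} [CommRing R] (u : Rˣ)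

/-- Constant labels satisfy every crossing equation. -/
lemma wirtingerMatrix_row_sum {n : ℕ} (a : Fin (n + 1) → Fin (n + 1)) (ε : Fin (n + 1) → ℤ)
    (k : Fin (n + 1)) : ∑ j, wirtingerMatrix u a ε k j = 0 := by
  simp [wirtingerMatrix, Finset.sum_add_distrib, Finset.sum_sub_distrib]

lemma wirtingerMatrix_mulVec {n : ℕ} (a : Fin (n + 1) → Fin (n + 1)) (ε : Fin (n + 1) → ℤ)
    (k : Fin (n + 1)) (y : Fin (n + 1) → R) :
    ∑ j, wirtingerMatrix u a ε k j * y j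
      = y (a k) + ((u ^ ε k : Rˣ) : R) * (y k - y (a k)) - y (k + 1) := by
  simp only [wirtingerMatrix, Matrix.of_apply, Pi.add_apply, Pi.sub_apply, add_mul, sub_mul,
    Finset.sum_add_distrib, Finset.sum_sub_distrib, Pi.single_apply, ite_mul, zero_mul,
    Finset.sum_ite_eq', Finset.mem_univ, if_true]
  ring

/-- The minor of the Alexander matrix without the first column is, up to a unit, the minor without
the last column. -/
lemma associated_det_wirtingerMatrix {n : ℕ} (a : Fin (n + 1) → Fin (n + 1))
    (ε : Fin (n + 1) → ℤ) :
    Associated ((wirtingerMatrix u a ε).submatrix Fin.castSucc Fin.succ).det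
      ((wirtingerMatrix u a ε).submatrix Fin.castSucc Fin.castSucc).det := by
  have h := Matrix.submatrix_succAbove_det_eq_negOnePow_submatrix_succAbove_det'
    ((wirtingerMatrix u a ε).submatrix Fin.castSucc id)
    (fun i => wirtingerMatrix_row_sum u a ε i.castSucc) 0 (Fin.last n)
  simp only [Matrix.submatrix_submatrix, Fin.succAbove_zero,
    Function.id_comp, Function.comp_id] at h
  rw [show (Fin.last n).succAbove = Fin.castSucc from funext fun i => Fin.succAbove_last_apply i]
    at h
  change ((wirtingerMatrix u a ε).submatrix Fin.castSucc Fin.succ).det = _ at h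
  rw [h]
  rcases Int.units_eq_one_or (Int.negOnePow (((0 : Fin (n + 1)) : ℤ) - (Fin.last n : ℤ)))
    with h1 | h1
  · rw [h1, one_smul]
  · rw [h1, Units.neg_smul, one_smul]
    exact (Associated.refl _).neg_left

end

/-! ### Elimination around the braid axis. -/

/-- The crossings at which the arcs other than arc `0` begin that run through the half-plane where
the elimination starts. -/
def initialCrossing : Fin 4 → Fin 47 := ![7, 16, 27, 36]

/-- The crossings in the order in which they are passed in a full turn about the braid axis. -/
def crossingTime (k : Fin 47) : ℕ := (underLetter k.castSucc + 9) % 48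

/-- The crossings, without the initial ones, in the order of elimination. -/
def eliminationOrder : List ℕ :=
  [17, 37, 18, 8, 19, 38, 28, 20, 39, 9, 0, 29, 1, 10, 11, 2, 21, 40, 30, 3, 31, 12, 22, 23, 41,
    13, 42, 32, 43, 14, 4, 44, 15, 33, 24, 5, 25, 34, 35, 26, 45, 6, 46]

/-- Multiplication by `t ^ e` for `e = 1` or `e = -1`. -/
def LaurentList.mulSign (e : ℤ) (a : LaurentList) : LaurentList :=
  if e = 1 then a.mulT else a.divT

/-- The label of the arc that leaves the crossing `k`, for given labels `y` of the arcs. -/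
def outgoingLabel (y : List LaurentList) (k : Fin 48) : LaurentList :=
  let o := y.getD (overIndex k) (.const 0)
  o + (y.getD k (.const 0) - o).mulSign (letterSign (underLetter k))

/-- The labels of all arcs, when the initial arc number `j` has the label `1` and the other initial
arcs have the label `0`. -/
def arcLabels (j : Fin 4) : List LaurentList :=
  eliminationOrder.foldl (fun y k => y.set (k + 1) (outgoingLabel y (Fin.ofNat 48 k)))
    ((List.replicate 48 (.const 0)).set ((initialCrossing j).val + 1) (.const 1))

/-- The label of the arc `k`. -/
def arcLabel (j : Fin 4) (k : Fin 48) : LaurentList := (arcLabels j).getD k (.const 0)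

/-- The defect of the labels at the crossing `k`. -/
def labelDefect (j : Fin 4) (k : Fin 47) : LaurentList :=
  outgoingLabel (arcLabels j) k.castSucc - arcLabel j k.succ

/-- Holds because the elimination order visits a crossing only after the labels of its incoming arc
and its overpass are final. -/
lemma labelDefect_isZero : ∀ k : Fin 47, (∀ i, initialCrossing i ≠ k) → ∀ j,
    (labelDefect j k).isZero = true := by
  decide +kernel

lemma arcLabel_zero : ∀ j, (arcLabel j 0).isZero = true := by
  decide +kernel

lemma arcLabel_initialCrossing : ∀ i j, (arcLabel j (initialCrossing i).succ
    - .const (if i = j then 1 else 0)).isZero = true := by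
  decide +kernel

/-- The value of the Conway polynomial at `z`, where `x = z ^ 2`. -/
def conwayList (x : LaurentList) : LaurentList :=
  .const 1 + x * (.const (-3) + x * (.const (-33) + x * (.const 54 + x * (.const 535
    + x * (.const 869 + x * (.const 489 + x * .const 72))))))

/-- The closing conditions at the four initial crossings; the list stands for `z² = t - 2 + t⁻¹`. -/
lemma detFour_labelDefect : (LaurentList.detFour (fun i j => labelDefect j (initialCrossing i))
    - conwayList ⟨1, [1, -2, 1]⟩).isZero = true := by
  decide +kernel

section

variable {R : Type*} [CommRing R] (u : Rˣ)

lemma LaurentList.eval_mulSign {e : ℤ} (he : e = 1 ∨ e = -1) (a : LaurentList) :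
    eval u (a.mulSign e) = ((u ^ e : Rˣ) : R) * eval u a := by
  rcases he with rfl | rfl
  · simp [mulSign]
  · rw [mulSign, if_neg (by decide), eval_divT, zpow_neg_one]

/-- The Alexander matrix of the closed braid without its first column and last row. -/
def reducedWirtingerMatrix : Matrix (Fin 47) (Fin 47) R :=
  (wirtingerMatrix u overIndex fun k => letterSign (underLetter k)).submatrix
    Fin.castSucc Fin.succ

/-- The values of the labels. -/
def labelMatrix : Matrix (Fin 47) (Fin 4) R :=
  Matrix.of fun k j => (arcLabel j k.succ).eval u

lemma reducedWirtingerMatrix_mul_labelMatrix (k : Fin 47) (j : Fin 4) :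
    (reducedWirtingerMatrix u * labelMatrix u) k j = (labelDefect j k).eval u := by
  have h := wirtingerMatrix_mulVec u overIndex (fun k => letterSign (underLetter k)) k.castSucc
    fun i => (arcLabel j i).eval u
  rw [Fin.sum_univ_succ, LaurentList.eval_eq_zero u (arcLabel_zero j), mul_zero, zero_add,
    Fin.coeSucc_eq_succ] at h
  rw [Matrix.mul_apply]
  refine h.trans ?_
  rw [labelDefect, outgoingLabel, LaurentList.eval_sub, LaurentList.eval_add,
    LaurentList.eval_mulSign u (letterSign_eq _), LaurentList.eval_sub]
  rfl

/-- The triangularity of the elimination: apart from arc 0 and the four initial arcs, a crossing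
involves as incoming or over arc only arcs that begin strictly earlier in the turn. -/
lemma overIndex_ne {i j : Fin 47} (hi : ¬∃ k, initialCrossing k = i)
    (hj : ¬∃ k, initialCrossing k = j) (hij : crossingTime i ≤ crossingTime j) :
    overIndex i.castSucc ≠ j.succ ∧ i.castSucc ≠ j.succ := by
  revert i j
  decide +kernel

lemma injective_crossingTime : Function.Injective crossingTime := by
  unfold Function.Injective
  decide +kernel

lemma reducedWirtingerMatrix_apply {i j : Fin 47} (hi : ¬∃ k, initialCrossing k = i)
    (hj : ¬∃ k, initialCrossing k = j) (hij : crossingTime i ≤ crossingTime j) :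
    reducedWirtingerMatrix u i j = if i = j then -1 else 0 := by
  obtain ⟨h1, h2⟩ := overIndex_ne hi hj hij
  have h3 : j.succ = i.succ ↔ i = j := by rw [Fin.succ_inj, eq_comm]
  simp only [reducedWirtingerMatrix, wirtingerMatrix, Matrix.submatrix_apply, Matrix.of_apply,
    Pi.add_apply, Pi.sub_apply, Pi.single_apply, Fin.coeSucc_eq_succ, h1.symm, h2.symm, h3,
    if_false]
  split_ifs <;> simp

lemma associated_det_reducedWirtingerMatrix :
    Associated ((conwayList ⟨1, [1, -2, 1]⟩).eval u) (reducedWirtingerMatrix u).det := by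
  rw [Matrix.det_eq_det_mul_prod (reducedWirtingerMatrix u) initialCrossing (by decide)
    (fun i => ∃ k, initialCrossing k = i) (fun i => Iff.rfl) crossingTime injective_crossingTime
    (labelMatrix u)]
  · rw [Finset.prod_congr rfl fun i _ => (reducedWirtingerMatrix_apply u i.2 i.2 le_rfl).trans
      (if_pos rfl), Finset.prod_const, LaurentList.det_eq_detFour]
    have h1 := LaurentList.eval_eq_zero u detFour_labelDefect
    rw [LaurentList.eval_sub, sub_eq_zero, LaurentList.eval_detFour] at h1
    simp only [Matrix.submatrix_apply, reducedWirtingerMatrix_mul_labelMatrix, id]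
    rw [← h1]
    -- The eliminated diagonal entries are all `-1`, so their product is a unit.
    exact associated_mul_unit_right _ _ (isUnit_one.neg.pow _)
  · intro i j
    have h1 := LaurentList.eval_eq_zero u (arcLabel_initialCrossing i j)
    rw [LaurentList.eval_sub, sub_eq_zero, LaurentList.eval_const] at h1
    rw [labelMatrix, Matrix.of_apply, h1, Matrix.one_apply]
    split_ifs <;> simp
  · intro i hi j
    rw [reducedWirtingerMatrix_mul_labelMatrix]
    exact LaurentList.eval_eq_zero u (labelDefect_isZero i (fun k hk => hi ⟨k, hk⟩) j)
  · intro i j hi hj hij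
    rw [reducedWirtingerMatrix_apply u hi hj hij.le, if_neg]
    rintro rfl
    exact lt_irrefl _ hij

lemma LaurentList.eval_conwayList (x : LaurentList) :
    eval u (conwayList x) = 1 - 3 * eval u x - 33 * eval u x ^ 2 + 54 * eval u x ^ 3
      + 535 * eval u x ^ 4 + 869 * eval u x ^ 5 + 489 * eval u x ^ 6 + 72 * eval u x ^ 7 := by
  simp only [conwayList, eval_add, eval_mul, eval_const]
  push_cast
  ring

end

lemma eval_sq_T_sub_T :
    LaurentList.eval laurentT ⟨1, [1, -2, 1]⟩ = (T 1 - T (-1) : LaurentPolynomial ℤ) ^ 2 := by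
  have h1 : (T 1 * T (-1) : LaurentPolynomial ℤ) = 1 := by rw [← T_add]; simp
  have h2 : (T 2 : LaurentPolynomial ℤ) = T 1 * T 1 := by rw [← T_add]; simp
  have h3 : (T (-2) : LaurentPolynomial ℤ) = T (-1) * T (-1) := by rw [← T_add]; simp
  simp only [LaurentList.eval, LaurentList.evalCoeffs, pow_one]
  change (T (-2) : LaurentPolynomial ℤ) * (((1 : ℤ) : LaurentPolynomial ℤ) + T 2 * (
    ((-2 : ℤ) : LaurentPolynomial ℤ) + T 2 * (((1 : ℤ) : LaurentPolynomial ℤ) + T 2 * 0))) = _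
  rw [h2, h3]
  push_cast
  linear_combination ((T 1 * T (-1) + 1) * T 1 * T 1 - 2 * T 1 * T (-1) : LaurentPolynomial ℤ) * h1

/-! ### The Conway polynomial and the counterexample. -/

theorem hasConwayPolynomial_closureCurve :
    HasConwayPolynomial braidWW.closureCurve (1 - 3 * Polynomial.X ^ 2 - 33 * Polynomial.X ^ 4
      + 54 * Polynomial.X ^ 6 + 535 * Polynomial.X ^ 8 + 869 * Polynomial.X ^ 10
      + 489 * Polynomial.X ^ 12 + 72 * Polynomial.X ^ 14) := by
  -- The closed braid is its own regular diagram, with 47 + 1 crossings.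
  refine ⟨?_, _, AmbientIsotopic.refl _, 47, _, _, isDiagram_closureCurve, ?_⟩
  · rw [Polynomial.coeff_zero_eq_eval_zero]
    simp
  · rw [alexanderMinor, alexanderMatrix_closureCurve]
    refine Associated.trans ?_ (associated_det_wirtingerMatrix laurentT _ _)
    convert! associated_det_reducedWirtingerMatrix laurentT using 1
    rw [LaurentList.eval_conwayList, eval_sq_T_sub_T]
    simp only [map_add, map_sub, map_mul, map_pow, map_one, Polynomial.aeval_X, map_ofNat]
    ring

theorem mainTheorem7 (C : Polynomial ℤ)
    (hC : C = 1 - 3 * Polynomial.X ^ 2 - 33 * Polynomial.X ^ 4 + 54 * Polynomial.X ^ 6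
      + 535 * Polynomial.X ^ 8 + 869 * Polynomial.X ^ 10 + 489 * Polynomial.X ^ 12
      + 72 * Polynomial.X ^ 14) :
    IsKnot braidWW.closureCurve ∧
    Set.range braidWW.closureCurve = braidWW.closure ∧
    HasConwayPolynomial braidWW.closureCurve C ∧
    PositiveAmphicheiral (toS3 ∘ braidWW.closureCurve) ∧
    C.leadingCoeff = 72 ∧
    ¬ IsSquare (72 : ℤ) ∧
    ¬ SquareLeadingCoeffConjecture := by
  have hlead : C.leadingCoeff = 72 := by
    have hdeg : C.natDegree = 14 := by
      rw [hC]
      compute_degree!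
    rw [Polynomial.leadingCoeff, hdeg, hC]
    compute_degree!
  have hsq : ¬ IsSquare (72 : ℤ) := by
    rintro ⟨a, ha⟩
    have h1 : a.natAbs * a.natAbs = 72 := by
      rw [← Int.natAbs_mul, ← ha]
      rfl
    have h2 : a.natAbs < 9 := by nlinarith
    interval_cases a.natAbs <;> omega
  have hconway : HasConwayPolynomial braidWW.closureCurve C :=
    hC ▸ hasConwayPolynomial_closureCurve
  refine ⟨isKnot_closureCurve, range_closureCurve, hconway, positiveAmphicheiral_closureCurve,
    hlead, hsq, fun h => hsq ?_⟩
  have := h _ isKnot_closureCurve positiveAmphicheiral_closureCurve.amphicheiral C hconway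
  rwa [hlead] at this
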